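/- Let $(X_i)_{i\in\mathbb Z}$ be a real stationary sequence with a filtration $(\mathcal F_i)_{i\in\mathbb Z}$ on a probability space $(\Omega,\mathcal F,\mathbb P)$, given in one of the following two ways. (a) $T:\Omega\to\Omega$ is bijective, bimeasurable and preserves $\mathbb P$; $\mathcal F_0\subseteq\mathcal F$ is a $\sigma$-algebra with $\mathcal F_0\subseteq T^{-1}(\mathcal F_0)$; $\mathcal F_i=T^{-i}(\mathcal F_0)$ and $X_i=X_0\circ T^i$, where $X_0$ is $\mathcal F_0$-measurable with $\mathbb E(X_0)=0$ and $\mathbb E(X_0^2)<\infty$. (b) $(\xi_i)_{i\in\mathbb Z}$ is a (strictly) stationary Markov chain with values in a measurable space and marginal law $\pi$; $\mathcal F_i=\sigma(\xi_j:j\le i)$ and $X_i=f(\xi_i)$, where $\int f^2\,d\pi<\infty$ and $\int f\,d\pi=0$. Put $S_n=\sum_{i=0}^{n-1}X_i$ and let $\|\cdot\|$ be the norm of $L^2(\mathbb P)$. Let $(b_n)_{n\ge1}$ be a sequence of positive numbers that is nondecreasing, slowly varying (that is, $b_{\lfloor\lambda n\rfloor}/b_n\to1$ as $n\to\infty$ for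 every $\lambda>0$) and satisfies $\sum_{n\ge1}(nb_n)^{-1}<\infty$, and suppose that $$\sum_{n\ge1}\frac{b_n}{n}\Big(\sum_{k\ge n}\frac{\|\mathbb E(S_k\mid\mathcal F_0)\|}{k^{3/2}}\Big)^2<\infty .$$ Then there is a stationary sequence $(D_k)_{k\in\mathbb Z}$ of square integrable martingale differences, with $D_k$ $\mathcal F_{k+1}$-measurable and $\mathbb E(D_k\mid\mathcal F_k)=0$ a.s. for all $k\in\mathbb Z$ (and $D_k=D_0\circ T^k$ in case (a)), such that the martingale $M_n=\sum_{i=0}^{n-1}D_i$, $n\ge 0$, with respect to $(\mathcal F_n)_{n\ge0}$, satisfies $$\frac{S_n-M_n}{\sqrt n}\to0\quad\text{a.s.}$$ For every $\gamma>1$ the sequence $b_n=(\log n)(\log\log n)^\gamma$, $n\ge3$, continued by $b_1=b_2=b_3$, has the properties required of $(b_n)$. -/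

import Mathlib

open MeasureTheory ProbabilityTheory Filter Topology
open scoped ENNReal

namespace MartApprox

/-! ### Sequences of weights -/

/-- A (positive) sequence is slowly varying if `b ⌊l n⌋ / b n → 1` for every `l > 0`. -/
def SlowlyVarying (b : ℕ → ℝ) : Prop :=
  ∀ l : ℝ, 0 < l → Tendsto (fun n : ℕ => b ⌊l * (n : ℝ)⌋₊ / b n) atTop (𝓝 1)

/-- Requirements on the weights `(b_n)_{n ≥ 1}`: positive, nondecreasing, slowly varying, and
`∑_{n ≥ 1} (n b_n)⁻¹ < ∞`. The value `b 0` plays no role. -/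
structure AdmissibleWeights (b : ℕ → ℝ) : Prop where
  pos : ∀ n : ℕ, 1 ≤ n → 0 < b n
  nondecreasing : ∀ m n : ℕ, 1 ≤ m → m ≤ n → b m ≤ b n
  slowlyVarying : SlowlyVarying b
  summable : Summable (fun n : ℕ => (((n + 1 : ℕ) : ℝ) * b (n + 1))⁻¹)

/-- The iterated logarithm `log₂ x = log (log (max e x))`. -/
noncomputable def log₂ (x : ℝ) : ℝ := Real.log (Real.log (max (Real.exp 1) x))

/-- The weights `b_n = (log n) (log₂ n) ^ γ` for `n ≥ 3`, continued by `b_n = b_3` for `n < 3`. -/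
noncomputable def logWeights (γ : ℝ) (n : ℕ) : ℝ :=
  Real.log ((max n 3 : ℕ) : ℝ) * (log₂ ((max n 3 : ℕ) : ℝ)) ^ γ

/-! ### Stationary processes and their filtrations -/

/-- Strict stationarity of a process indexed by `ℤ`: the law of the whole process is invariant
under time shifts. -/
def IsStationary {Ω S : Type*} [MeasurableSpace Ω] [MeasurableSpace S]
    (ξ : ℤ → Ω → S) (P : Measure Ω) : Prop :=
  ∀ k : ℤ, IdentDistrib (fun ω (i : ℤ) => ξ (i + k) ω) (fun ω (i : ℤ) => ξ i ω) P P

/-- The filtration `F_k = σ(ξ_i : i ≤ k)` generated by a process indexed by `ℤ`. -/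
def pastFiltration {Ω S : Type*} [mΩ : MeasurableSpace Ω] [mS : MeasurableSpace S]
    (ξ : ℤ → Ω → S) (hξ : ∀ i, Measurable (ξ i)) : Filtration ℤ mΩ where
  seq k := ⨆ (i : ℤ) (_ : i ≤ k), mS.comap (ξ i)
  mono' := fun _ _ hjk => iSup₂_le fun i hi =>
    le_iSup₂ (f := fun (i : ℤ) _ => mS.comap (ξ i)) i (hi.trans hjk)
  le' := fun _ => iSup₂_le fun i _ => (hξ i).comap_le

/-- The Markov property: given the past up to time `k`, the conditional law of `ξ_{k+1}` only
depends on `ξ_k`. -/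
def HasMarkovProperty {Ω S : Type*} [mΩ : MeasurableSpace Ω] [mS : MeasurableSpace S]
    (ξ : ℤ → Ω → S) (hξ : ∀ i, Measurable (ξ i)) (P : Measure Ω) : Prop :=
  ∀ (k : ℤ) (A : Set S), MeasurableSet A →
    P[(ξ (k + 1) ⁻¹' A).indicator (fun _ => (1 : ℝ)) | pastFiltration ξ hξ k]
      =ᵐ[P] P[(ξ (k + 1) ⁻¹' A).indicator (fun _ => (1 : ℝ)) | mS.comap (ξ k)]

/-- The iterate `T ^ i`, `i ∈ ℤ`, of a bijective bimeasurable transformation. -/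
def iter {Ω : Type*} [MeasurableSpace Ω] (T : Ω ≃ᵐ Ω) (i : ℤ) : Ω → Ω :=
  ⇑((T.toEquiv : Equiv.Perm Ω) ^ i)

theorem iter_add_one {Ω : Type*} [MeasurableSpace Ω] (T : Ω ≃ᵐ Ω) (i : ℤ) :
    iter T (i + 1) = T ∘ iter T i := by
  funext ω
  simp only [iter, Function.comp_apply]
  rw [add_comm, zpow_add, zpow_one]
  rfl

theorem measurable_iter {Ω : Type*} [MeasurableSpace Ω] (T : Ω ≃ᵐ Ω) (i : ℤ) :
    Measurable (iter T i) := by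
  induction i using Int.induction_on with
  | zero => exact measurable_id
  | succ n ih => rw [iter_add_one]; exact T.measurable.comp ih
  | pred n ih =>
    have h : iter T (-(n : ℤ)) = T ∘ iter T (-(n : ℤ) - 1) := by
      rw [← iter_add_one, sub_add_cancel]
    have h2 : iter T (-(n : ℤ) - 1) = T.symm ∘ iter T (-(n : ℤ)) := by
      rw [h]; funext ω; simp
    rw [h2]; exact T.symm.measurable.comp ih

/-- The filtration `F_i = T^{-i}(F_0)`, `i ∈ ℤ`, where `F_0 ⊆ T^{-1}(F_0)`. -/
def shiftFiltration {Ω : Type*} (F₀ : MeasurableSpace Ω) [mΩ : MeasurableSpace Ω]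
    (T : Ω ≃ᵐ Ω) (hF₀ : F₀ ≤ mΩ) (hT : F₀ ≤ F₀.comap T) : Filtration ℤ mΩ where
  seq i := F₀.comap (iter T i)
  mono' := by
    refine monotone_int_of_le_succ fun i => ?_
    rw [iter_add_one, ← MeasurableSpace.comap_comp]
    exact MeasurableSpace.comap_mono hT
  le' := fun i => (MeasurableSpace.comap_mono hF₀).trans (measurable_iter T i).comap_le

/-- The restriction of a filtration indexed by `ℤ` to the times `0, 1, 2, …`. -/
def natFiltration {Ω : Type*} {mΩ : MeasurableSpace Ω} (F : Filtration ℤ mΩ) :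
    Filtration ℕ mΩ where
  seq n := F (n : ℤ)
  mono' := fun _ _ h => F.mono (Int.ofNat_le.mpr h)
  le' := fun n => F.le (n : ℤ)

/-- The partial sums `S_n = X_0 + ⋯ + X_{n-1}`. -/
def partialSum {Ω : Type*} (X : ℤ → Ω → ℝ) (n : ℕ) (ω : Ω) : ℝ :=
  ∑ i ∈ Finset.range n, X (i : ℤ) ω

/-! ### The condition and the approximation -/

/-- The tail `∑_{k ≥ n} ‖E(S_k | F_0)‖ / k^{3/2}` (with `k = n + j`), as an element of `[0, ∞]`;
`‖·‖` is the norm of `L²(P)`. It is used for `n ≥ 1` only. -/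
noncomputable def projTail {Ω : Type*} {mΩ : MeasurableSpace Ω} (P : Measure Ω)
    (F : Filtration ℤ mΩ) (X : ℤ → Ω → ℝ) (n : ℕ) : ℝ≥0∞ :=
  ∑' j : ℕ, eLpNorm (P[partialSum X (n + j) | F 0]) 2 P
    / ENNReal.ofReal (((n + j : ℕ) : ℝ) ^ (3 / 2 : ℝ))

/-- The condition `∑_{n ≥ 1} (b_n / n) (∑_{k ≥ n} ‖E(S_k | F_0)‖ / k^{3/2})² < ∞`
(the outer sum is written with `n + 1`, `n ≥ 0`, in place of `n`). -/
def SlowCondition {Ω : Type*} {mΩ : MeasurableSpace Ω} (P : Measure Ω)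
    (F : Filtration ℤ mΩ) (X : ℤ → Ω → ℝ) (b : ℕ → ℝ) : Prop :=
  ∑' n : ℕ, ENNReal.ofReal (b (n + 1) / ((n + 1 : ℕ) : ℝ)) * projTail P F X (n + 1) ^ 2 < ∞

/-- `(D_k)_{k ∈ ℤ}` is a stationary sequence of square integrable martingale differences, `D_k`
being `F_{k+1}`-measurable with `E(D_k | F_k) = 0`, and `M_n = D_0 + ⋯ + D_{n-1}` is a martingale
with `(S_n - M_n) / √n → 0` almost surely. -/
structure IsASMartingaleApprox {Ω : Type*} {mΩ : MeasurableSpace Ω} (P : Measure Ω)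
    (F : Filtration ℤ mΩ) (X D : ℤ → Ω → ℝ) : Prop where
  stationary : IsStationary D P
  memLp : ∀ k : ℤ, MemLp (D k) 2 P
  adapted : ∀ k : ℤ, StronglyMeasurable[F (k + 1)] (D k)
  condExp_eq_zero : ∀ k : ℤ, P[D k | F k] =ᵐ[P] 0
  martingale : Martingale (partialSum D) (natFiltration F) P
  tendsto : ∀ᵐ ω ∂P, Tendsto
    (fun n : ℕ => (partialSum X n ω - partialSum D n ω) / Real.sqrt n) atTop (𝓝 0)

end MartApprox

/-! Let `U` be the Koopman isometry of `L²`, `K` the closed subspace of `F₀`-measurable functions,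
`E` the projection onto `K`, and `q = E U`. Then `K ⊆ U K`, so for `x = X₀` one has `E(S_n | F₀) =
V_n x` with `V_n = 1 + q + ⋯ + q^(n-1)`; write `a n` for its norm.

The martingale. The dyadic averages `2^{-i} V_{2^i} x` telescope, and each increment is a coboundary
`(1 - q) h_i` with an explicit potential `h_i`. Replacing `q` by `U` costs the innovation `e_i = U
h_i - q h_i`, of norm at most `a(2^i) / 2^{i/2}`. These bounds are summable, so `d = ∑ e_i` exists,
lies in `U K ∩ Kᗮ`, and generates the martingale differences. Cutting the sum at level `J` bounds
the `L²` norm of `S_n - M_n` at `n = 2^J` by coboundaries, orthogonal innovations and a remainder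
(`exists_innovation_approx`).

The rate. The weighted condition turns this bound into `∑ β_i 2^{-i} ‖S_{2^i} - M_{2^i}‖² < ∞` for
weights with `∑ 1/β_i < ∞` (`AdmissibleWeights.exists_dyadic_weights`).

From `L²` to almost sure. A sum of length `n` is rewritten pathwise through dyadic averages at
levels up to `log₂ n`; Cauchy–Schwarz with weights `β_i` bounds it by ergodic sums of one integrable
function, which are `O(n)` by the maximal ergodic theorem. High levels carry a tail of `∑ 1/β_i`,
and finitely many low levels are `o(√n)` (`sum_isLittleO_sqrt`, `ae_birkhoffSum_isLittleO_sqrt`).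

Case (b) follows from case (a) for the shift on path space, since the condition and the conclusion
both transport along the path map. -/

namespace MartApprox

/-! ### Martingale–coboundary decomposition in Hilbert space -/

section HilbertSpace

variable {H : Type*} [NormedAddCommGroup H] [InnerProductSpace ℝ H]

/-- The compression `E U` of an isometry `U` to the range of the orthogonal projection `E`. -/
noncomputable def compression (U : H →ₗᵢ[ℝ] H) (K : Submodule ℝ H) [K.HasOrthogonalProjection] :
    H →L[ℝ] H :=
  K.starProjection * U.toContinuousLinearMap

/-- The sum `1 + q + ⋯ + q ^ (n - 1)` of the powers of a bounded operator. -/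
noncomputable def powerSum (q : H →L[ℝ] H) (n : ℕ) : H →L[ℝ] H := ∑ k ∈ Finset.range n, q ^ k

theorem powerSum_add (q : H →L[ℝ] H) (m n : ℕ) :
    powerSum q (m + n) = powerSum q m + q ^ m * powerSum q n := by
  simp only [powerSum, Finset.sum_range_add, Finset.mul_sum, pow_add]

theorem norm_pow_apply_le {q : H →L[ℝ] H} (hq : ∀ x, ‖q x‖ ≤ ‖x‖) (n : ℕ) (x : H) :
    ‖(q ^ n) x‖ ≤ ‖x‖ := by
  induction n with
  | zero => simp
  | succ n ih => rw [pow_succ']; exact (hq _).trans ih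

theorem norm_powerSum_apply_le {q : H →L[ℝ] H} (hq : ∀ x, ‖q x‖ ≤ ‖x‖) (n : ℕ) (x : H) :
    ‖powerSum q n x‖ ≤ n * ‖x‖ := by
  simp only [powerSum, sum_apply]
  refine (norm_sum_le _ _).trans ((Finset.sum_le_sum fun k _ => norm_pow_apply_le hq k x).trans ?_)
  simp

/-- Because `V_m = V_{m+n} - q^m V_n` and `q` is a contraction. This replaces monotonicity of `‖V_n
x‖` when single dyadic values are compared with averages. -/
theorem norm_powerSum_le_add {q : H →L[ℝ] H} (hq : ∀ x, ‖q x‖ ≤ ‖x‖) (m n : ℕ) (x : H) :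
    ‖powerSum q m x‖ ≤ ‖powerSum q n x‖ + ‖powerSum q (n + m) x‖ := by
  have h : powerSum q m x = powerSum q (m + n) x - (q ^ m) (powerSum q n x) := by
    rw [powerSum_add]; simp
  rw [h, add_comm (‖powerSum q n x‖), add_comm n m]
  exact (norm_sub_le _ _).trans (add_le_add_right (norm_pow_apply_le hq m _) _)

/-- The Poisson equation potentials of the dyadic averages. -/
noncomputable def dyadicPotential (q : H →L[ℝ] H) (x : H) (i : ℕ) : H :=
  ((2 : ℝ) ^ (i + 1))⁻¹ • powerSum q (2 ^ i) (powerSum q (2 ^ i) x)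

theorem norm_dyadicPotential_le {q : H →L[ℝ] H} (hq : ∀ x, ‖q x‖ ≤ ‖x‖) (x : H) (i : ℕ) :
    ‖dyadicPotential q x i‖ ≤ ‖powerSum q (2 ^ i) x‖ / 2 := by
  rw [dyadicPotential, norm_smul, norm_inv, norm_pow, Real.norm_two, inv_mul_le_iff₀ (by positivity)]
  refine (norm_powerSum_apply_le hq _ _).trans (le_of_eq ?_)
  push_cast; ring

/-- With `N = 2^i`, combine `(1 - q) V_N = 1 - q^N` and `V_{2N} = V_N + q^N V_N`. The right side
telescopes in `i`, so the potentials solve the Poisson equation up to an average. -/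
theorem dyadicPotential_sub (q : H →L[ℝ] H) (x : H) (i : ℕ) :
    dyadicPotential q x i - q (dyadicPotential q x i)
      = ((2 : ℝ) ^ i)⁻¹ • powerSum q (2 ^ i) x
        - ((2 : ℝ) ^ (i + 1))⁻¹ • powerSum q (2 ^ (i + 1)) x := by
  have h1 : powerSum q (2 ^ (i + 1)) x
      = powerSum q (2 ^ i) x + (q ^ (2 ^ i)) (powerSum q (2 ^ i) x) := by
    rw [pow_succ, mul_two, powerSum_add]; simp
  have h2 : ∀ y, powerSum q (2 ^ i) y - q (powerSum q (2 ^ i) y) = y - (q ^ (2 ^ i)) y := by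
    intro y
    have := congrArg (fun A : H →L[ℝ] H => A y) (mul_neg_geom_sum q (2 ^ i))
    simpa [powerSum, sum_apply] using this
  rw [dyadicPotential, map_smul, ← smul_sub, h2, h1, smul_add, smul_sub, pow_succ, mul_inv]
  module

theorem norm_dyadicPotential_sub_le {q : H →L[ℝ] H} (hq : ∀ x, ‖q x‖ ≤ ‖x‖) (x : H) (i : ℕ) :
    ‖dyadicPotential q x i - q (dyadicPotential q x i)‖
      ≤ ((2 : ℝ) ^ i)⁻¹ * ‖powerSum q (2 ^ i) x‖ := by
  have h1 : powerSum q (2 ^ (i + 1)) x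
      = powerSum q (2 ^ i) x + (q ^ (2 ^ i)) (powerSum q (2 ^ i) x) := by
    rw [pow_succ, mul_two, powerSum_add]; simp
  have h2 : ((2 : ℝ) ^ i)⁻¹ • powerSum q (2 ^ i) x
        - ((2 : ℝ) ^ (i + 1))⁻¹ • powerSum q (2 ^ (i + 1)) x
      = ((2 : ℝ) ^ (i + 1))⁻¹ • (powerSum q (2 ^ i) x - (q ^ (2 ^ i)) (powerSum q (2 ^ i) x)) := by
    rw [h1, pow_succ, mul_inv]
    module
  rw [dyadicPotential_sub, h2, norm_smul, norm_inv, norm_pow, Real.norm_two, pow_succ, mul_inv,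
    mul_assoc]
  refine mul_le_mul_of_nonneg_left ?_ (by positivity)
  have := (norm_sub_le (powerSum q (2 ^ i) x) ((q ^ (2 ^ i)) (powerSum q (2 ^ i) x))).trans
    (add_le_add_right (norm_pow_apply_le hq (2 ^ i) _) _)
  linarith

variable (U : H →ₗᵢ[ℝ] H) {K : Submodule ℝ H}

/-- Each `y ∈ K` is `U z` with `z ∈ K`, and `⟪U z, U v⟫ = ⟪z, v⟫ = 0`. -/
theorem iterate_mem_orthogonal (hK : K ≤ K.map U.toLinearMap) {v : H} (hv : v ∈ Kᗮ) (n : ℕ) :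
    (U.toContinuousLinearMap ^ n) v ∈ Kᗮ := by
  induction n with
  | zero => simpa
  | succ n ih =>
    rw [pow_succ']
    intro y hy
    obtain ⟨z, hz, rfl⟩ := hK hy
    exact (U.inner_map_map _ _).trans (ih z hz)

/-- For `e ∈ U K ∩ Kᗮ` the vectors `U^k e` are pairwise orthogonal, as martingale differences are,
so Pythagoras applies. -/
theorem norm_powerSum_innovation_le (hK : K ≤ K.map U.toLinearMap) {e : H}
    (he : e ∈ K.map U.toLinearMap) (he' : e ∈ Kᗮ) (n : ℕ) :
    ‖powerSum U.toContinuousLinearMap n e‖ ≤ √n * ‖e‖ := by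
  have horth : ∀ n, inner ℝ e (U (powerSum U.toContinuousLinearMap n e)) = 0 := by
    intro n
    obtain ⟨z, hz, rfl⟩ := he
    refine (U.inner_map_map _ _).trans ?_
    simp only [powerSum, sum_apply, inner_sum]
    exact Finset.sum_eq_zero fun k _ => iterate_mem_orthogonal U hK he' k z hz
  have hsq : ∀ n : ℕ, ‖powerSum U.toContinuousLinearMap n e‖ ^ 2 = n * ‖e‖ ^ 2 := by
    intro n
    induction n with
    | zero => simp [powerSum]
    | succ n ih =>
      have : powerSum U.toContinuousLinearMap (n + 1) e
          = e + U (powerSum U.toContinuousLinearMap n e) := by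
        rw [add_comm, powerSum_add]
        simp [powerSum]
      rw [this, norm_add_sq_real, horth, U.norm_map, ih]
      push_cast; ring
  refine abs_le_of_sq_le_sq' ?_ (by positivity) |>.2
  rw [hsq, mul_pow, Real.sq_sqrt (Nat.cast_nonneg n)]

variable (K) [K.HasOrthogonalProjection]

theorem compression_apply (x : H) : compression U K x = K.starProjection (U x) := rfl

theorem norm_compression_apply_le (x : H) : ‖compression U K x‖ ≤ ‖x‖ := by
  rw [compression_apply]
  exact (K.norm_starProjection_apply_le _).trans (U.norm_map x).le

/-- The innovation `U h - E U h`. -/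
noncomputable def innovation : H →L[ℝ] H := U.toContinuousLinearMap - compression U K

theorem innovation_apply (h : H) : innovation U K h = U h - K.starProjection (U h) := rfl

theorem innovation_mem_orthogonal (h : H) : innovation U K h ∈ Kᗮ :=
  K.sub_starProjection_mem_orthogonal _

/-- The left side is `‖h‖² - ‖q h‖²`, which factors. The factor `‖h - q h‖` is what makes
innovations of large potentials small. -/
theorem norm_innovation_sq_le (h : H) :
    ‖innovation U K h‖ ^ 2 ≤ 2 * ‖h - compression U K h‖ * ‖h‖ := by
  have h1 := K.norm_sq_eq_add_norm_sq_starProjection (U h)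
  have h2 : U h - K.starProjection (U h) = Kᗮ.starProjection (U h) := by
    rw [Submodule.starProjection_orthogonal']; simp
  rw [← h2, ← innovation_apply, ← compression_apply, U.norm_map] at h1
  have h3 := norm_sub_norm_le h (compression U K h)
  have h4 := norm_compression_apply_le U K h
  nlinarith [norm_nonneg h, norm_nonneg (compression U K h), norm_nonneg (h - compression U K h)]

variable {K}

/-- Since `U` maps `Kᗮ` into itself, `E U = E U E = q E`. This identifies `E(S_n | F₀)` with a power
sum of `q`. -/
theorem starProjection_powerSum (hK : K ≤ K.map U.toLinearMap) {x : H} (hx : x ∈ K) (n : ℕ) :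
    K.starProjection (powerSum U.toContinuousLinearMap n x) = powerSum (compression U K) n x := by
  have hcomm : ∀ y, K.starProjection (U y) = compression U K (K.starProjection y) := by
    intro y
    have h1 : U (y - K.starProjection y) ∈ Kᗮ := by
      simpa using iterate_mem_orthogonal U hK (K.sub_starProjection_mem_orthogonal y) 1
    have h2 := (K.starProjection_apply_eq_zero_iff).2 h1
    rw [map_sub, map_sub, sub_eq_zero] at h2
    exact h2
  simp only [powerSum, sum_apply, map_sum]
  refine Finset.sum_congr rfl fun k hk => ?_
  clear hk
  induction k with
  | zero => simpa using K.starProjection_eq_self_iff.2 hx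
  | succ k ih =>
    rw [pow_succ', pow_succ']
    exact (hcomm _).trans (congrArg _ ih)

theorem powerSum_compression_mem {x : H} (hx : x ∈ K) (n : ℕ) :
    powerSum (compression U K) n x ∈ K := by
  simp only [powerSum, sum_apply]
  refine K.sum_mem fun k _ => ?_
  cases k with
  | zero => simpa
  | succ k => rw [pow_succ']; exact K.starProjection_apply_mem _

/-- The limit of the innovations of the dyadic potentials approximates the partial sums. -/
theorem exists_innovation_approx [CompleteSpace H] (hK : K ≤ K.map U.toLinearMap) {x : H}
    (hx : x ∈ K)
    (hsum : Summable fun i : ℕ => ‖powerSum (compression U K) (2 ^ i) x‖ / √(2 ^ i)) :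
    ∃ d ∈ K.map U.toLinearMap, d ∈ Kᗮ ∧ ∀ J : ℕ,
      ‖powerSum U.toContinuousLinearMap (2 ^ J) (x - d)‖
        ≤ ∑ i ∈ Finset.range J, ‖powerSum (compression U K) (2 ^ i) x‖
          + √(2 ^ J) * (∑' i : ℕ, ‖powerSum (compression U K) (2 ^ (i + J)) x‖ / √(2 ^ (i + J)))
          + ‖powerSum (compression U K) (2 ^ J) x‖ := by
  set q := compression U K with hqdef
  have hq : ∀ x, ‖q x‖ ≤ ‖x‖ := norm_compression_apply_le U K
  set h := dyadicPotential q x with hh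
  set e : ℕ → H := fun i => innovation U K (h i) with he
  have hhK : ∀ i, h i ∈ K := fun i =>
    K.smul_mem _ (powerSum_compression_mem U (powerSum_compression_mem U hx _) _)
  have heK : ∀ i, e i ∈ K.map U.toLinearMap := fun i =>
    Submodule.sub_mem _ (Submodule.mem_map_of_mem (hhK i)) (hK (K.starProjection_apply_mem _))
  have heK' : ∀ i, e i ∈ Kᗮ := fun i => innovation_mem_orthogonal U K _
  have hbd : ∀ i, ‖e i‖ ≤ ‖powerSum q (2 ^ i) x‖ / √(2 ^ i) := by
    intro i
    refine abs_le_of_sq_le_sq' ?_ (by positivity) |>.2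
    refine (norm_innovation_sq_le U K (h i)).trans ?_
    rw [div_pow, Real.sq_sqrt (by positivity)]
    have h1 := norm_dyadicPotential_sub_le hq x i
    have h2 := norm_dyadicPotential_le hq x i
    calc 2 * ‖h i - q (h i)‖ * ‖h i‖
        ≤ 2 * (((2 : ℝ) ^ i)⁻¹ * ‖powerSum q (2 ^ i) x‖) * (‖powerSum q (2 ^ i) x‖ / 2) := by
          gcongr
      _ = _ := by field_simp
  have hes : Summable e := Summable.of_norm_bounded hsum hbd
  -- Closedness of `U K` and `Kᗮ` keeps the infinite sums of innovations in both, so tails are again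
  -- martingale differences.
  have hclosed : IsClosed ((K.map U.toLinearMap : Submodule ℝ H) : Set H) := by
    have hKc : IsClosed (K : Set H) := by
      rw [← K.orthogonal_orthogonal]; exact Submodule.isClosed_orthogonal _
    rw [Submodule.map_coe]
    exact (U.isometry.isClosedEmbedding.isClosedMap) _ hKc
  have htail : ∀ J, (∑' i, e (i + J)) ∈ K.map U.toLinearMap ∧ (∑' i, e (i + J)) ∈ Kᗮ := fun J =>
    have hs := ((summable_nat_add_iff J).2 hes).hasSum
    ⟨hclosed.mem_of_tendsto hs (.of_forall fun s => Submodule.sum_mem _ fun i _ => heK _),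
     (Submodule.isClosed_orthogonal K).mem_of_tendsto hs
      (.of_forall fun s => Submodule.sum_mem _ fun i _ => heK' _)⟩
  refine ⟨∑' i, e i, (htail 0).1, (htail 0).2, fun J => ?_⟩
  -- Below level `J` the innovations combine with `h i - q (h i)` into true coboundaries of `U`;
  -- above it they stay as a martingale tail. The three pieces give the three terms of the bound.
  have hdec : x - ∑' i, e i = (∑ i ∈ Finset.range J, (h i - U (h i))) - ∑' i, e (i + J)
      + ((2 : ℝ) ^ J)⁻¹ • powerSum q (2 ^ J) x := by
    rw [← hes.sum_add_tsum_nat_add J]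
    have h1 : ∑ i ∈ Finset.range J, (h i - q (h i)) = x - ((2 : ℝ) ^ J)⁻¹ • powerSum q (2 ^ J) x := by
      rw [Finset.sum_congr rfl fun i _ => dyadicPotential_sub q x i, Finset.sum_range_sub']
      simp [powerSum]
    have h2 : ∀ i, h i - U (h i) = (h i - q (h i)) - e i := by
      intro i
      simp only [he, innovation_apply, hqdef, compression_apply]; abel
    rw [Finset.sum_congr rfl fun i _ => h2 i, Finset.sum_sub_distrib, h1]
    abel
  have hU : ∀ y, ‖U.toContinuousLinearMap y‖ ≤ ‖y‖ := fun y => (U.norm_map y).le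
  rw [hdec, map_add, map_sub, map_sum]
  refine (norm_add_le _ _).trans (add_le_add ((norm_sub_le _ _).trans (add_le_add ?_ ?_)) ?_)
  · refine (norm_sum_le _ _).trans (Finset.sum_le_sum fun i _ => ?_)
    have h3 : powerSum U.toContinuousLinearMap (2 ^ J) (h i - U (h i))
        = h i - (U.toContinuousLinearMap ^ (2 ^ J)) (h i) := by
      have := congrArg (fun A : H →L[ℝ] H => A (h i))
        (geom_sum_mul_neg U.toContinuousLinearMap (2 ^ J))
      simpa [powerSum, sum_apply] using this
    rw [h3]
    refine (norm_sub_le _ _).trans ?_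
    have h4 := norm_dyadicPotential_le hq x i
    have h5 := norm_pow_apply_le hU (2 ^ J) (h i)
    linarith
  · refine (norm_powerSum_innovation_le U hK (htail J).1 (htail J).2 _).trans ?_
    push_cast
    exact mul_le_mul_of_nonneg_left (tsum_of_norm_bounded
      ((summable_nat_add_iff J).2 hsum).hasSum fun i => hbd _) (by positivity)
  · refine (norm_powerSum_apply_le hU _ _).trans ?_
    rw [norm_smul, norm_inv, norm_pow, Real.norm_two]
    push_cast
    rw [mul_inv_cancel_left₀ (by positivity)]

end HilbertSpace

/-! ### Pathwise dyadic chaining -/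

section DyadicChaining

/-- The average of `y` over the window `p, …, p + 2 ^ i - 1`. -/
noncomputable def dyadicAvg (y : ℕ → ℝ) (i p : ℕ) : ℝ :=
  ((2 : ℝ) ^ i)⁻¹ * ∑ l ∈ Finset.range (2 ^ i), y (p + l)

/-- The sum of the dyadic averages over the window `p, …, p + 2 ^ i - 1`. -/
noncomputable def windowSum (y : ℕ → ℝ) (i p : ℕ) : ℝ :=
  ∑ l ∈ Finset.range (2 ^ i), dyadicAvg y i (p + l)

theorem dyadicAvg_zero (y : ℕ → ℝ) (p : ℕ) : dyadicAvg y 0 p = y p := by simp [dyadicAvg]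

theorem dyadicAvg_succ (y : ℕ → ℝ) (i p : ℕ) :
    dyadicAvg y (i + 1) p = (dyadicAvg y i p + dyadicAvg y i (p + 2 ^ i)) / 2 := by
  simp only [dyadicAvg]
  rw [pow_succ (2 : ℕ) i, mul_two (2 ^ i : ℕ), Finset.sum_range_add, pow_succ (2 : ℝ), mul_inv]
  simp only [add_assoc]
  ring

/-- A level `i + 1` average is the mean of two level `i` averages at distance `2^i`, so summing over
`n` positions leaves only two boundary windows. -/
theorem sum_dyadicAvg_sub (y : ℕ → ℝ) (i n : ℕ) :
    ∑ k ∈ Finset.range n, dyadicAvg y i k - ∑ k ∈ Finset.range n, dyadicAvg y (i + 1) k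
      = (windowSum y i 0 - windowSum y i n) / 2 := by
  have h1 := Finset.sum_range_add (dyadicAvg y i) (2 ^ i) n
  have h2 := Finset.sum_range_add (dyadicAvg y i) n (2 ^ i)
  rw [add_comm, h2] at h1
  simp only [dyadicAvg_succ, windowSum, zero_add, ← Finset.sum_div, Finset.sum_add_distrib]
  simp only [add_comm _ (2 ^ i)]
  linarith

theorem sum_eq_windowSum_add (y : ℕ → ℝ) (n J : ℕ) :
    ∑ k ∈ Finset.range n, y k = (∑ i ∈ Finset.range J, windowSum y i 0
      - ∑ i ∈ Finset.range J, windowSum y i n) / 2 + ∑ k ∈ Finset.range n, dyadicAvg y J k := by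
  rw [← Finset.sum_sub_distrib, Finset.sum_div,
    ← Finset.sum_congr rfl fun i _ => sum_dyadicAvg_sub y i n, Finset.sum_range_sub']
  simp [dyadicAvg_zero]

variable {y β G : ℕ → ℝ}

/-- Cauchy–Schwarz twice: across levels with weights `β i`, then inside each window. Enlarging all
windows to length `2^J` allows the sums to be exchanged. -/
theorem sq_sum_windowSum_le (hβ : ∀ i, 0 < β i)
    (hG : ∀ p J, ∑ i ∈ Finset.range J, β i * (2 ^ i * dyadicAvg y i p ^ 2) ≤ G p) (p m J : ℕ) :
    (∑ i ∈ Finset.Ico m J, windowSum y i p) ^ 2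
      ≤ (∑ i ∈ Finset.Ico m J, (β i)⁻¹) * ∑ l ∈ Finset.range (2 ^ J), G (p + l) := by
  refine (Finset.sum_sq_le_sum_mul_sum_of_sq_le_mul (Finset.Ico m J)
    (f := fun i => (β i)⁻¹) (g := fun i => β i * windowSum y i p ^ 2)
    (fun i _ => (inv_pos.2 (hβ i)).le) (fun i _ => mul_nonneg (hβ i).le (sq_nonneg _))
    (fun i _ => (inv_mul_cancel_left₀ (hβ i).ne' _).ge)).trans ?_
  refine mul_le_mul_of_nonneg_left ?_ (Finset.sum_nonneg fun i _ => (inv_pos.2 (hβ i)).le)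
  have hnn : ∀ i p, 0 ≤ β i * (2 ^ i * dyadicAvg y i p ^ 2) := fun i p =>
    mul_nonneg (hβ i).le (by positivity)
  calc ∑ i ∈ Finset.Ico m J, β i * windowSum y i p ^ 2
      ≤ ∑ i ∈ Finset.Ico m J, ∑ l ∈ Finset.range (2 ^ J),
          β i * (2 ^ i * dyadicAvg y i (p + l) ^ 2) := by
        refine Finset.sum_le_sum fun i hi => ?_
        have h1 : windowSum y i p ^ 2
            ≤ 2 ^ i * ∑ l ∈ Finset.range (2 ^ i), dyadicAvg y i (p + l) ^ 2 := by
          have := sq_sum_le_card_mul_sum_sq (s := Finset.range (2 ^ i))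
            (f := fun l => dyadicAvg y i (p + l))
          simpa [windowSum] using this
        refine (mul_le_mul_of_nonneg_left h1 (hβ i).le).trans ?_
        rw [Finset.mul_sum, Finset.mul_sum]
        refine Finset.sum_le_sum_of_subset_of_nonneg ?_ fun l _ _ => hnn _ _
        exact Finset.range_subset_range.2
          (Nat.pow_le_pow_right two_pos (Finset.mem_Ico.1 hi).2.le)
    _ = ∑ l ∈ Finset.range (2 ^ J), ∑ i ∈ Finset.Ico m J,
          β i * (2 ^ i * dyadicAvg y i (p + l) ^ 2) := Finset.sum_comm
    _ ≤ _ := by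
        refine Finset.sum_le_sum fun l _ => le_trans ?_ (hG (p + l) J)
        refine Finset.sum_le_sum_of_subset_of_nonneg (fun i hi => ?_) fun i _ _ => hnn _ _
        exact Finset.mem_range.2 (Finset.mem_Ico.1 hi).2

theorem sq_sum_dyadicAvg_le (hβ : ∀ i, 0 < β i)
    (hG : ∀ p J, ∑ i ∈ Finset.range J, β i * (2 ^ i * dyadicAvg y i p ^ 2) ≤ G p) (n J : ℕ) :
    (∑ k ∈ Finset.range n, dyadicAvg y J k) ^ 2
      ≤ n * ((β J * 2 ^ J)⁻¹ * ∑ k ∈ Finset.range n, G k) := by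
  have h := sq_sum_le_card_mul_sum_sq (s := Finset.range n) (f := dyadicAvg y J)
  rw [Finset.card_range] at h
  refine h.trans (mul_le_mul_of_nonneg_left ?_ (Nat.cast_nonneg n))
  have hpos : 0 < β J * 2 ^ J := mul_pos (hβ J) (by positivity)
  rw [Finset.mul_sum]
  refine Finset.sum_le_sum fun k _ => ?_
  rw [le_inv_mul_iff₀ hpos]
  have h1 := hG k (J + 1)
  rw [Finset.sum_range_succ] at h1
  have h2 : 0 ≤ ∑ i ∈ Finset.range J, β i * (2 ^ i * dyadicAvg y i k ^ 2) :=
    Finset.sum_nonneg fun i _ => mul_nonneg (hβ i).le (by positivity)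
  linarith

theorem windowSum_isLittleO (hy : y =o[atTop] fun n : ℕ => √(n : ℝ)) (i : ℕ) :
    (fun n => windowSum y i n) =o[atTop] fun n : ℕ => √(n : ℝ) := by
  have hshift : ∀ c : ℕ, (fun n => y (n + c)) =o[atTop] fun n : ℕ => √(n : ℝ) := by
    intro c
    refine (hy.comp_tendsto (tendsto_add_atTop_nat c)).trans_isBigO ?_
    refine Asymptotics.IsBigO.of_bound (√(1 + c)) ?_
    filter_upwards [eventually_ge_atTop 1] with n hn
    have hn' : (1 : ℝ) ≤ n := by exact_mod_cast hn
    simp only [Function.comp, Real.norm_eq_abs, abs_of_nonneg (Real.sqrt_nonneg _)]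
    rw [← Real.sqrt_mul (by positivity)]
    refine Real.sqrt_le_sqrt ?_
    push_cast
    nlinarith [(Nat.cast_nonneg c : (0 : ℝ) ≤ c)]
  have havg : ∀ l : ℕ, (fun n => dyadicAvg y i (n + l)) =o[atTop] fun n : ℕ => √(n : ℝ) := by
    intro l
    unfold dyadicAvg
    refine Asymptotics.IsLittleO.const_mul_left (Asymptotics.IsLittleO.fun_sum fun l' _ => ?_) _
    simpa only [add_assoc] using hshift (l + l')
  exact Asymptotics.IsLittleO.fun_sum fun l _ => havg l

/-- Dyadic chaining: control of the dyadic averages in mean square along the sequence implies that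
the partial sums are `o(√n)`. -/
theorem sum_isLittleO_sqrt (hβ : ∀ i, 0 < β i) (hβs : Summable fun i => (β i)⁻¹)
    (hG : ∀ p J, ∑ i ∈ Finset.range J, β i * (2 ^ i * dyadicAvg y i p ^ 2) ≤ G p)
    {C : ℝ} (hC : ∀ n : ℕ, ∑ k ∈ Finset.range n, G k ≤ C * n)
    (hy : y =o[atTop] fun n : ℕ => √(n : ℝ)) :
    (fun n => ∑ k ∈ Finset.range n, y k) =o[atTop] fun n : ℕ => √(n : ℝ) := by
  have hG0 : ∀ p, 0 ≤ G p := fun p => by simpa using hG p 0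
  have hC0 : 0 ≤ C := by simpa using (hG0 0).trans (by simpa using hC 1)
  set t : ℕ → ℝ := fun m => ∑' i, (β (i + m))⁻¹ with ht
  have hts : ∀ m, Summable fun i => (β (i + m))⁻¹ := fun m => (summable_nat_add_iff m).2 hβs
  have ht0 : Tendsto (fun m => 2 * √(2 * C * t m)) atTop (𝓝 0) := by
    have h1 : Tendsto t atTop (𝓝 0) := tendsto_sum_nat_add fun i => (β i)⁻¹
    have h2 : Tendsto (fun m => 2 * √(2 * C * t m)) atTop (𝓝 (2 * √(2 * C * 0))) :=
      ((h1.const_mul (2 * C)).sqrt).const_mul 2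
    simpa using h2
  have htn : ∀ m, 0 ≤ t m := fun m => tsum_nonneg fun i => (inv_pos.2 (hβ _)).le
  rw [Asymptotics.isLittleO_iff]
  intro ε hε
  -- Levels from `m` to `J` contribute half of two window sums, and the level `J` average one more
  -- term, each at most `√(2 C t_m) √n`; hence the factor `2`. The levels below `m` are finite in
  -- number and take the other `ε / 2`.
  obtain ⟨m, hm⟩ := (ht0.eventually_lt_const (half_pos hε)).exists
  have hA : (fun n : ℕ => ∑ i ∈ Finset.range m, (|windowSum y i 0| + |windowSum y i n|))
      =o[atTop] fun n : ℕ => √(n : ℝ) := by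
    refine Asymptotics.IsLittleO.fun_sum fun i _ => Asymptotics.IsLittleO.add ?_ ?_
    · refine Asymptotics.isLittleO_const_left.2 (Or.inr ?_)
      exact (tendsto_norm_atTop_atTop).comp (Real.tendsto_sqrt_atTop.comp tendsto_natCast_atTop_atTop)
    · exact (windowSum_isLittleO hy i).abs_left
  filter_upwards [Asymptotics.isLittleO_iff.1 hA hε, eventually_ge_atTop (2 ^ m)] with n hn hnm
  have hn0 : n ≠ 0 := (lt_of_lt_of_le (by positivity) hnm).ne'
  set J := Nat.log 2 n with hJ
  have hJm : m ≤ J := (Nat.le_log_iff_pow_le one_lt_two hn0).2 hnm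
  have hJ1 : 2 ^ J ≤ n := Nat.pow_log_le_self 2 hn0
  have hJ2 : n < 2 ^ (J + 1) := Nat.lt_pow_succ_log_self one_lt_two n
  have hico : ∑ i ∈ Finset.Ico m J, (β i)⁻¹ ≤ t m := by
    rw [Finset.sum_Ico_eq_sum_range]
    simp only [add_comm m]
    exact (hts m).sum_le_tsum _ fun i _ => (inv_pos.2 (hβ _)).le
  have hβJ : (β J)⁻¹ ≤ t m := by
    have := (hts m).le_tsum (J - m) fun i _ => (inv_pos.2 (hβ _)).le
    rwa [Nat.sub_add_cancel hJm] at this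
  have hwin : ∀ p : ℕ, p = 0 ∨ p = n → |∑ i ∈ Finset.Ico m J, windowSum y i p|
      ≤ √(2 * C * t m) * √n := by
    intro p hp
    rw [← Real.sqrt_mul (mul_nonneg (by positivity) (htn m))]
    refine Real.abs_le_sqrt ((sq_sum_windowSum_le hβ hG p m J).trans ?_)
    have h1 : ∑ l ∈ Finset.range (2 ^ J), G (p + l) ≤ C * (2 * n) := by
      calc ∑ l ∈ Finset.range (2 ^ J), G (p + l)
          ≤ ∑ l ∈ Finset.range (p + 2 ^ J), G l := by
            rw [Finset.sum_range_add]
            exact le_add_of_nonneg_left (Finset.sum_nonneg fun i _ => hG0 i)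
        _ ≤ C * (p + 2 ^ J : ℕ) := hC _
        _ ≤ C * (2 * n) := by
            refine mul_le_mul_of_nonneg_left ?_ hC0
            have : p + 2 ^ J ≤ 2 * n := by omega
            exact_mod_cast this
    calc _ ≤ t m * (C * (2 * n)) :=
          mul_le_mul hico h1 (Finset.sum_nonneg fun l _ => hG0 _) (htn m)
      _ = _ := by ring
  have havg : |∑ k ∈ Finset.range n, dyadicAvg y J k| ≤ √(2 * C * t m) * √n := by
    rw [← Real.sqrt_mul (mul_nonneg (by positivity) (htn m))]
    refine Real.abs_le_sqrt ((sq_sum_dyadicAvg_le hβ hG n J).trans ?_)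
    have hn2 : (n : ℝ) ≤ 2 * 2 ^ J := by
      have : n ≤ 2 * 2 ^ J := by rw [pow_succ] at hJ2; omega
      exact_mod_cast this
    have h2J : (0 : ℝ) < 2 ^ J := by positivity
    calc (n : ℝ) * ((β J * 2 ^ J)⁻¹ * ∑ k ∈ Finset.range n, G k)
        ≤ n * ((β J * 2 ^ J)⁻¹ * (C * n)) := by
          have := hβ J
          gcongr
          exact hC n
      _ = (n * (2 ^ J)⁻¹) * ((β J)⁻¹ * (C * n)) := by rw [mul_inv]; ring
      _ ≤ 2 * (t m * (C * n)) := by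
          have := htn m
          have := hβ J
          gcongr
          rwa [mul_inv_le_iff₀ h2J]
      _ = _ := by ring
  have hsplit : ∀ p, ∑ i ∈ Finset.range J, windowSum y i p
      = ∑ i ∈ Finset.range m, windowSum y i p + ∑ i ∈ Finset.Ico m J, windowSum y i p :=
    fun p => (Finset.sum_range_add_sum_Ico _ hJm).symm
  have hsq : 0 ≤ √(n : ℝ) := Real.sqrt_nonneg _
  rw [Real.norm_eq_abs, Real.norm_of_nonneg hsq] at *
  have h0 := abs_le.1 (hwin 0 (Or.inl rfl))
  have h1 := abs_le.1 (hwin n (Or.inr rfl))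
  have h2 := abs_le.1 havg
  have h3 := (le_abs_self _).trans hn
  rw [Finset.sum_add_distrib] at h3
  have h4 := abs_le.1 (Finset.abs_sum_le_sum_abs (fun i => windowSum y i 0) (Finset.range m))
  have h5 := abs_le.1 (Finset.abs_sum_le_sum_abs (fun i => windowSum y i n) (Finset.range m))
  have h6 : 2 * √(2 * C * t m) * √n ≤ ε / 2 * √n := mul_le_mul_of_nonneg_right hm.le hsq
  rw [sum_eq_windowSum_add y n J, hsplit, hsplit, abs_le]
  constructor <;> linarith [h0.1, h0.2, h1.1, h1.2, h2.1, h2.2, h4.1, h4.2, h5.1, h5.2]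

end DyadicChaining

/-! ### Maximal ergodic lemma and the almost sure bound -/

section MaximalErgodic

variable {Ω : Type*} {T : Ω → Ω}

/-- The running maximum `max (0, S_1 f, …, S_n f)` of the Birkhoff sums of `f`. -/
noncomputable def birkhoffMax (T : Ω → Ω) (f : Ω → ℝ) : ℕ → Ω → ℝ
  | 0 => 0
  | n + 1 => fun ω => max 0 (f ω + birkhoffMax T f n (T ω))

theorem birkhoffMax_nonneg (f : Ω → ℝ) (n : ℕ) (ω : Ω) : 0 ≤ birkhoffMax T f n ω := by
  cases n with
  | zero => exact le_rfl
  | succ n => exact le_max_left _ _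

theorem birkhoffMax_le_succ (f : Ω → ℝ) (n : ℕ) (ω : Ω) :
    birkhoffMax T f n ω ≤ birkhoffMax T f (n + 1) ω := by
  induction n generalizing ω with
  | zero => exact birkhoffMax_nonneg f 1 ω
  | succ n ih => exact max_le_max le_rfl (add_le_add_right (ih (T ω)) _)

theorem birkhoffSum_le_birkhoffMax (f : Ω → ℝ) (n : ℕ) (ω : Ω) :
    birkhoffSum T f n ω ≤ birkhoffMax T f n ω := by
  induction n generalizing ω with
  | zero => simp [birkhoffMax]
  | succ n ih =>
    rw [birkhoffSum_succ']
    exact (add_le_add_right (ih (T ω)) _).trans (le_max_right _ _)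

theorem dyadicAvg_iterate (Y : Ω → ℝ) (ω : Ω) (i p : ℕ) :
    dyadicAvg (fun n => Y (T^[n] ω)) i p = ((2 : ℝ) ^ i)⁻¹ * birkhoffSum T Y (2 ^ i) (T^[p] ω) := by
  simp only [dyadicAvg, birkhoffSum, ← Function.iterate_add_apply]
  simp only [add_comm p]

variable [MeasurableSpace Ω] {P : Measure Ω}

theorem integrable_birkhoffMax (hT : MeasurePreserving T P P) {f : Ω → ℝ} (hf : Integrable f P)
    (n : ℕ) : Integrable (birkhoffMax T f n) P := by
  induction n with
  | zero => exact integrable_zero _ _ _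
  | succ n ih =>
    exact (integrable_zero _ _ _).sup (hf.add (hT.integrable_comp_of_integrable ih))

theorem measurable_birkhoffMax (hT : Measurable T) {f : Ω → ℝ} (hf : Measurable f) (n : ℕ) :
    Measurable (birkhoffMax T f n) := by
  induction n with
  | zero => exact measurable_const
  | succ n ih => exact measurable_const.max (hf.add (ih.comp hT))

/-- Hopf's maximal ergodic lemma. -/
theorem setIntegral_birkhoffMax_nonneg (hT : MeasurePreserving T P P) {f : Ω → ℝ}
    (hfm : Measurable f) (hf : Integrable f P) (n : ℕ) :
    0 ≤ ∫ ω in {ω | 0 < birkhoffMax T f n ω}, f ω ∂P := by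
  cases n with
  | zero => simp [birkhoffMax]
  | succ n =>
    set A := {ω | 0 < birkhoffMax T f (n + 1) ω}
    have hA : MeasurableSet A := measurableSet_lt measurable_const
      (measurable_birkhoffMax hT.measurable hfm (n + 1))
    have hi1 := integrable_birkhoffMax hT hf (n + 1)
    have hi0 := integrable_birkhoffMax hT hf n
    have hiT : Integrable (fun ω => birkhoffMax T f n (T ω)) P :=
      hT.integrable_comp_of_integrable hi0
    -- Where the maximum is positive it is attained by its second argument, so `f` there is the
    -- difference of `birkhoffMax` at `n + 1` and its value at `n` along `T`.
    have h1 : ∫ ω in A, f ω ∂P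
        = ∫ ω in A, (birkhoffMax T f (n + 1) ω - birkhoffMax T f n (T ω)) ∂P := by
      refine setIntegral_congr_fun hA fun ω hω => ?_
      have hω' : 0 < max 0 (f ω + birkhoffMax T f n (T ω)) := hω
      have h2 : birkhoffMax T f (n + 1) ω = f ω + birkhoffMax T f n (T ω) :=
        max_eq_right (le_of_lt (by simpa using hω'))
      simp only [h2]; ring
    have h3 : ∫ ω, birkhoffMax T f n (T ω) ∂P = ∫ ω, birkhoffMax T f n ω ∂P := by
      conv_rhs => rw [← hT.map_eq]
      rw [integral_map hT.measurable.aemeasurable]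
      exact (measurable_birkhoffMax hT.measurable hfm n).aestronglyMeasurable
    have h4 : ∫ ω in A, birkhoffMax T f (n + 1) ω ∂P = ∫ ω, birkhoffMax T f (n + 1) ω ∂P := by
      refine setIntegral_eq_integral_of_forall_compl_eq_zero fun ω hω => ?_
      exact le_antisymm (not_lt.1 hω) (birkhoffMax_nonneg f _ ω)
    have h5 : ∫ ω in A, birkhoffMax T f n (T ω) ∂P ≤ ∫ ω, birkhoffMax T f n (T ω) ∂P :=
      setIntegral_le_integral hiT (.of_forall fun ω => birkhoffMax_nonneg f n _)
    have h6 : ∫ ω, birkhoffMax T f n ω ∂P ≤ ∫ ω, birkhoffMax T f (n + 1) ω ∂P :=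
      integral_mono hi0 hi1 fun ω => birkhoffMax_le_succ f n ω
    rw [h1, integral_sub hi1.integrableOn hiT.integrableOn, h4]
    linarith

/-- The Birkhoff averages of a nonnegative integrable function are almost surely bounded. -/
theorem ae_exists_birkhoffSum_le [IsProbabilityMeasure P] (hT : MeasurePreserving T P P)
    {g : Ω → ℝ} (hgm : Measurable g) (hg : Integrable g P) (hg0 : 0 ≤ g) :
    ∀ᵐ ω ∂P, ∃ C : ℝ, ∀ n : ℕ, birkhoffSum T g n ω ≤ C * n := by
  have hweak : ∀ c : ℕ, (c : ℝ) * P.real {ω | ∃ n : ℕ, (c : ℝ) * n < birkhoffSum T g n ω}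
      ≤ ∫ ω, g ω ∂P := by
    intro c
    -- The maximal lemma for `g - c` gives the weak-type bound `c P(A_n) ≤ ∫ g`, uniformly in `n`.
    set f : Ω → ℝ := fun ω => g ω - c
    have hfm : Measurable f := hgm.sub_const _
    have hfi : Integrable f P := hg.sub (integrable_const _)
    set A : ℕ → Set Ω := fun n => {ω | 0 < birkhoffMax T f n ω}
    have hAm : ∀ n, MeasurableSet (A n) := fun n => measurableSet_lt measurable_const
      (measurable_birkhoffMax hT.measurable hfm n)
    have hA : ∀ n, (c : ℝ) * P.real (A n) ≤ ∫ ω, g ω ∂P := by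
      intro n
      have h1 := setIntegral_birkhoffMax_nonneg hT hfm hfi n
      rw [integral_sub hg.integrableOn (integrable_const _).integrableOn, setIntegral_const,
        smul_eq_mul] at h1
      have h2 := setIntegral_le_integral (s := A n) hg (.of_forall hg0)
      have h3 : (c : ℝ) * P.real (A n) = P.real (A n) * c := mul_comm _ _
      linarith
    have hmono : Monotone A := monotone_nat_of_le_succ fun n ω hω =>
      lt_of_lt_of_le hω (birkhoffMax_le_succ f n ω)
    have hsub : {ω | ∃ n : ℕ, (c : ℝ) * n < birkhoffSum T g n ω} ⊆ ⋃ n, A n := by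
      rintro ω ⟨n, hn⟩
      refine Set.mem_iUnion.2 ⟨n, lt_of_lt_of_le ?_ (birkhoffSum_le_birkhoffMax f n ω)⟩
      have : birkhoffSum T f n ω = birkhoffSum T g n ω - c * n := by
        simp only [birkhoffSum, f, Finset.sum_sub_distrib]
        simp [mul_comm]
      rw [this]; linarith
    have hlim : Tendsto (fun n => (c : ℝ) * P.real (A n)) atTop
        (𝓝 ((c : ℝ) * P.real (⋃ n, A n))) := by
      refine Tendsto.const_mul _ ?_
      exact (ENNReal.tendsto_toReal (measure_ne_top _ _)).comp
        (tendsto_measure_iUnion_atTop hmono)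
    exact (mul_le_mul_of_nonneg_left (measureReal_mono hsub) (Nat.cast_nonneg c)).trans
      (le_of_tendsto' hlim hA)
  set B : Set Ω := {ω | ∀ c : ℕ, ∃ n : ℕ, (c : ℝ) * n < birkhoffSum T g n ω}
  have hB : P.real B = 0 := by
    by_contra hne
    have hpos : 0 < P.real B := lt_of_le_of_ne measureReal_nonneg (Ne.symm hne)
    obtain ⟨c, hc⟩ := exists_nat_gt ((∫ ω, g ω ∂P) / P.real B)
    rw [div_lt_iff₀ hpos] at hc
    have h1 : P.real B ≤ P.real {ω | ∃ n : ℕ, (c : ℝ) * n < birkhoffSum T g n ω} :=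
      measureReal_mono fun ω hω => hω c
    have h2 := mul_le_mul_of_nonneg_left h1 (Nat.cast_nonneg (α := ℝ) c)
    linarith [hweak c]
  have hB' : P B = 0 := by
    rwa [measureReal_eq_zero_iff] at hB
  filter_upwards [measure_eq_zero_iff_ae_notMem.1 hB'] with ω hω
  have hω' : ¬ ∀ c : ℕ, ∃ n : ℕ, (c : ℝ) * n < birkhoffSum T g n ω := hω
  push Not at hω'
  obtain ⟨c, hc⟩ := hω'
  exact ⟨c, hc⟩

/-- `Y ∘ T ^ n = o(√n)` almost surely for square integrable `Y`. -/
theorem ae_iterate_isLittleO_sqrt [IsProbabilityMeasure P] (hT : MeasurePreserving T P P)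
    {Y : Ω → ℝ} (hYm : Measurable Y) (hY : MemLp Y 2 P) :
    ∀ᵐ ω ∂P, (fun n => Y (T^[n] ω)) =o[atTop] fun n : ℕ => √(n : ℝ) := by
  have hbc : ∀ c : ℕ, ∀ᵐ ω ∂P, ∀ᶠ n : ℕ in atTop, (c : ℝ) * Y (T^[n] ω) ^ 2 ≤ n := by
    intro c
    let _ : MeasureSpace Ω := ⟨P⟩
    have : IsProbabilityMeasure (volume : Measure Ω) := ‹IsProbabilityMeasure P›
    -- Integrability of `c Y²` makes `∑ P(c Y² > n)` finite; invariance moves `Y` to `Y ∘ T^n`, and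
    -- Borel–Cantelli applies.
    have h1 := tsum_prob_mem_Ioi_lt_top (Ω := Ω) (X := fun ω => (c : ℝ) * Y ω ^ 2)
      (hY.integrable_sq.const_mul _) (fun ω => by positivity)
    have h2 : ∑' n : ℕ, P {ω | (n : ℝ) < c * Y (T^[n] ω) ^ 2} ≠ ∞ := by
      refine ne_of_lt (lt_of_le_of_lt (le_of_eq ?_) h1)
      refine tsum_congr fun n => ?_
      have hms : MeasurableSet {ω | (n : ℝ) < c * Y ω ^ 2} :=
        measurableSet_lt measurable_const ((hYm.pow_const 2).const_mul _)
      exact (hT.iterate n).measure_preimage hms.nullMeasurableSet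
    filter_upwards [ae_eventually_notMem h2] with ω hω
    filter_upwards [hω] with n hn
    exact not_lt.1 hn
  filter_upwards [ae_all_iff.2 hbc] with ω hω
  rw [Asymptotics.isLittleO_iff]
  intro ε hε
  obtain ⟨c, hc⟩ := exists_nat_gt ((ε ^ 2)⁻¹)
  filter_upwards [hω c] with n hn
  rw [Real.norm_eq_abs, Real.norm_of_nonneg (Real.sqrt_nonneg _)]
  refine abs_le_of_sq_le_sq (a := Y (T^[n] ω)) ?_ (by positivity)
  rw [mul_pow, Real.sq_sqrt (Nat.cast_nonneg n)]
  have hε2 : 0 < ε ^ 2 := by positivity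
  have h1 : 1 ≤ ε ^ 2 * c := by
    rw [inv_lt_iff_one_lt_mul₀ hε2] at hc
    linarith
  calc Y (T^[n] ω) ^ 2 ≤ (ε ^ 2 * c) * Y (T^[n] ω) ^ 2 :=
        le_mul_of_one_le_left (sq_nonneg _) h1
    _ = ε ^ 2 * (c * Y (T^[n] ω) ^ 2) := by ring
    _ ≤ _ := by gcongr

/-- A dyadic mean square rate implies that the Birkhoff sums are `o(√n)` almost surely. -/
theorem ae_birkhoffSum_isLittleO_sqrt [IsProbabilityMeasure P] (hT : MeasurePreserving T P P)
    {Y : Ω → ℝ} (hYm : Measurable Y) (hY : MemLp Y 2 P) {β : ℕ → ℝ} (hβ : ∀ i, 0 < β i)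
    (hβs : Summable fun i => (β i)⁻¹)
    (hsum : Summable fun i => β i * ((2 ^ i)⁻¹ * ∫ ω, birkhoffSum T Y (2 ^ i) ω ^ 2 ∂P)) :
    ∀ᵐ ω ∂P, (fun n => birkhoffSum T Y n ω) =o[atTop] fun n : ℕ => √(n : ℝ) := by
  -- Along the orbit, `F i (T^p ω)` is `β i * 2^i` times the squared dyadic average at `p`. The sum
  -- over `i` is integrable by `hsum` and serves as the majorant `G` of the chaining.
  set F : ℕ → Ω → ℝ := fun i ω => β i * ((2 ^ i)⁻¹ * birkhoffSum T Y (2 ^ i) ω ^ 2)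
  have hF0 : ∀ i ω, 0 ≤ F i ω := fun i ω => mul_nonneg (hβ i).le (by positivity)
  have hbm : ∀ n, Measurable (birkhoffSum T Y n) := fun n =>
    Finset.measurable_fun_sum _ fun k _ => hYm.comp (hT.measurable.iterate k)
  have hFm : ∀ i, Measurable (F i) := fun i => (((hbm _).pow_const 2).const_mul _).const_mul _
  have hbL : ∀ n, MemLp (birkhoffSum T Y n) 2 P := fun n =>
    memLp_finsetSum _ fun k _ => hY.comp_measurePreserving (hT.iterate k)
  have hFi : ∀ i, Integrable (F i) P := fun i => ((hbL _).integrable_sq.const_mul _).const_mul _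
  set G' : Ω → ℝ≥0∞ := fun ω => ∑' i, ENNReal.ofReal (F i ω)
  have hG'm : Measurable G' := Measurable.tsum fun i => (hFm i).ennreal_ofReal
  have hG' : ∫⁻ ω, G' ω ∂P ≠ ∞ := by
    rw [lintegral_tsum fun i => (hFm i).ennreal_ofReal.aemeasurable]
    have h1 : ∀ i, ∫⁻ ω, ENNReal.ofReal (F i ω) ∂P
        = ENNReal.ofReal (β i * ((2 ^ i)⁻¹ * ∫ ω, birkhoffSum T Y (2 ^ i) ω ^ 2 ∂P)) := by
      intro i
      rw [← ofReal_integral_eq_lintegral_ofReal (hFi i) (.of_forall (hF0 i))]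
      simp only [F, integral_const_mul]
    rw [tsum_congr h1]
    exact hsum.tsum_ofReal_ne_top
  have hfin : ∀ᵐ ω ∂P, ∀ p, G' (T^[p] ω) < ∞ := ae_all_iff.2 fun p =>
    (hT.iterate p).quasiMeasurePreserving.ae (ae_lt_top hG'm hG')
  have hGi : Integrable (fun ω => (G' ω).toReal) P :=
    integrable_toReal_of_lintegral_ne_top hG'm.aemeasurable hG'
  filter_upwards [hfin, ae_exists_birkhoffSum_le hT hG'm.ennreal_toReal hGi
    (fun ω => ENNReal.toReal_nonneg), ae_iterate_isLittleO_sqrt hT hYm hY] with ω h1 h2 h3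
  obtain ⟨C, hC⟩ := h2
  refine sum_isLittleO_sqrt hβ hβs (G := fun p => (G' (T^[p] ω)).toReal) (fun p J => ?_) hC h3
  have h4 : ∑ i ∈ Finset.range J, β i * (2 ^ i * dyadicAvg (fun n => Y (T^[n] ω)) i p ^ 2)
      = ∑ i ∈ Finset.range J, F i (T^[p] ω) := by
    refine Finset.sum_congr rfl fun i _ => ?_
    rw [dyadicAvg_iterate]
    simp only [F]
    field_simp
  rw [h4, ← ENNReal.ofReal_le_iff_le_toReal (h1 p).ne,
    ENNReal.ofReal_sum_of_nonneg fun i _ => hF0 i _]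
  exact ENNReal.sum_le_tsum _

end MaximalErgodic

/-! ### From the weighted condition to a dyadic rate -/

section Rates

/-- Summing the recursion and absorbing `ρ ∑ u` bounds `(1 - ρ) ∑ u` by the first term plus `∑ v`.
-/
theorem summable_of_contraction {u v : ℕ → ℝ} {ρ : ℝ} (hρ : ρ < 1) (hu : ∀ n, 0 ≤ u n)
    (hv : Summable v) (hv0 : ∀ n, 0 ≤ v n) (h : ∀ᶠ n in atTop, u (n + 1) ≤ ρ * u n + v n) :
    Summable u := by
  obtain ⟨N, hN⟩ := eventually_atTop.1 h
  rw [← summable_nat_add_iff N]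
  have hρ' : 0 < 1 - ρ := by linarith
  have hvN : Summable fun n => v (n + N) := (summable_nat_add_iff N).2 hv
  refine summable_of_sum_range_le (c := (1 - ρ)⁻¹ * (u N + ∑' n, v (n + N)))
    (fun n => hu _) fun n => ?_
  rw [le_inv_mul_iff₀ hρ']
  have h1 : ∑ k ∈ Finset.range n, u (k + 1 + N)
      ≤ ρ * ∑ k ∈ Finset.range n, u (k + N) + ∑ k ∈ Finset.range n, v (k + N) := by
    rw [Finset.mul_sum, ← Finset.sum_add_distrib]
    refine Finset.sum_le_sum fun k _ => ?_
    rw [add_right_comm]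
    exact hN _ (Nat.le_add_left _ _)
  have h2 : ∑ k ∈ Finset.range n, v (k + N) ≤ ∑' n, v (n + N) :=
    hvN.sum_le_tsum _ fun k _ => hv0 _
  have h3 := Finset.sum_range_succ (fun k => u (k + N)) n
  rw [Finset.sum_range_succ'] at h3
  have h4 := hu (n + N)
  simp only [zero_add] at h3
  linarith

theorem sum_block_le_sum_range {f B : ℕ → ℝ}
    (h : ∀ J, B J ≤ ∑ n ∈ Finset.Ico (2 ^ J + 1) (2 ^ (J + 1) + 1), f n)
    (hf : ∀ n, 0 ≤ f n) (N : ℕ) :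
    ∑ J ∈ Finset.range N, B J ≤ ∑ n ∈ Finset.range (2 ^ N + 1), f n := by
  induction N with
  | zero => simpa using Finset.sum_nonneg fun n _ => hf n
  | succ N ih =>
    rw [Finset.sum_range_succ, ← Finset.sum_range_add_sum_Ico f
      (show 2 ^ N + 1 ≤ 2 ^ (N + 1) + 1 by rw [pow_succ]; omega)]
    exact add_le_add ih (h N)

variable {a b : ℕ → ℝ}

theorem AdmissibleWeights.summable_inv_dyadic (hb : AdmissibleWeights b) :
    Summable fun J : ℕ => (b (2 ^ J))⁻¹ := by
  have h1 : Summable fun n : ℕ => ((n : ℝ) * b n)⁻¹ := by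
    rw [← summable_nat_add_iff 1]
    exact hb.summable
  have h2 := (summable_condensed_iff_of_nonneg (f := fun n : ℕ => ((n : ℝ) * b n)⁻¹)
    (fun n => ?_) (fun m n hm hmn => ?_)).2 h1
  · refine h2.congr fun J => ?_
    push_cast
    rw [mul_inv, mul_inv_cancel_left₀ (by positivity)]
  · rcases Nat.eq_zero_or_pos n with rfl | hn
    · simp
    · have := hb.pos n hn
      positivity
  · have h3 := hb.pos m hm
    have h4 := hb.nondecreasing m n hm hmn
    have : (0 : ℝ) < m := by exact_mod_cast hm
    gcongr

theorem AdmissibleWeights.eventually_dyadic_le (hb : AdmissibleWeights b) :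
    ∀ᶠ J : ℕ in atTop, b (2 ^ (J + 1)) ≤ 3 / 2 * b (2 ^ J) := by
  have h1 := (hb.slowlyVarying 2 two_pos).comp (tendsto_pow_atTop_atTop_of_one_lt one_lt_two)
  filter_upwards [h1.eventually_lt_const (show (1 : ℝ) < 3 / 2 by norm_num)] with J hJ
  have h2 : ⌊2 * ((2 ^ J : ℕ) : ℝ)⌋₊ = 2 ^ (J + 1) := by
    rw [show 2 * ((2 ^ J : ℕ) : ℝ) = ((2 ^ (J + 1) : ℕ) : ℝ) by push_cast; ring, Nat.floor_natCast]
  simp only [Function.comp, h2] at hJ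
  exact ((div_lt_iff₀ (hb.pos _ Nat.one_le_two_pow)).1 hJ).le

/-- On the block `2^J < n ≤ 2^{J+1}` the increasing `b` is smallest at the left end and the
decreasing `q` at the right end, whence the mismatched indices. -/
theorem AdmissibleWeights.summable_dyadic_mul_sq (hb : AdmissibleWeights b) {q : ℕ → ℝ}
    (hq0 : ∀ n, 0 ≤ q n) (hq : ∀ m n, 1 ≤ m → m ≤ n → q n ≤ q m)
    (h : Summable fun n : ℕ => b (n + 1) / ((n + 1 : ℕ) : ℝ) * q (n + 1) ^ 2) :
    Summable fun J : ℕ => b (2 ^ J) * q (2 ^ (J + 1)) ^ 2 := by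
  set f : ℕ → ℝ := fun n => b n / (n : ℝ) * q n ^ 2 with hf
  have hf0 : ∀ n, 0 ≤ f n := fun n => by
    rcases Nat.eq_zero_or_pos n with rfl | hn
    · simp [hf]
    · have := hb.pos n hn
      positivity
  have hfs : Summable f := (summable_nat_add_iff 1).1 h
  refine summable_of_sum_range_le (c := 2 * ∑' n, f n)
    (fun J => mul_nonneg (hb.pos _ Nat.one_le_two_pow).le (sq_nonneg _)) fun N => ?_
  have h1 : ∀ J, b (2 ^ J) * q (2 ^ (J + 1)) ^ 2 / 2
      ≤ ∑ n ∈ Finset.Ico (2 ^ J + 1) (2 ^ (J + 1) + 1), f n := by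
    intro J
    have hc : (Finset.Ico (2 ^ J + 1) (2 ^ (J + 1) + 1)).card = 2 ^ J := by
      rw [Nat.card_Ico, pow_succ]; omega
    have hbJ := hb.pos (2 ^ J) Nat.one_le_two_pow
    have h2 : ∀ n ∈ Finset.Ico (2 ^ J + 1) (2 ^ (J + 1) + 1),
        b (2 ^ J) / (2 ^ (J + 1)) * q (2 ^ (J + 1)) ^ 2 ≤ f n := by
      intro n hn
      rw [Finset.mem_Ico] at hn
      have hn1 : 2 ^ J ≤ n := by omega
      have hn0 : (0 : ℝ) < n := by
        have : 0 < n := by omega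
        exact_mod_cast this
      have hn2 : (n : ℝ) ≤ 2 ^ (J + 1) := by
        have : n ≤ 2 ^ (J + 1) := by omega
        exact_mod_cast this
      have h3 := hb.nondecreasing _ _ Nat.one_le_two_pow hn1
      have h4 := hq n (2 ^ (J + 1)) (by omega) (by omega)
      have h5 := hq0 (2 ^ (J + 1))
      have h6 := hbJ.trans_le h3
      simp only [hf]
      gcongr
    refine le_trans (le_of_eq ?_) (Finset.card_nsmul_le_sum _ _ _ h2)
    rw [hc, nsmul_eq_mul, pow_succ (2 : ℝ)]
    push_cast
    field_simp
  have h2 := (sum_block_le_sum_range h1 hf0 N).trans (hfs.sum_le_tsum _ fun n _ => hf0 n)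
  rw [← Finset.sum_div] at h2
  linarith

/-- Average `a m ≤ a n + a (n + m)` over `m ≤ n < 2m`. All indices stay below `4m`, where `n^{3/2} ≤
8 m^{3/2}`; the range up to `4m` consists of two dyadic blocks when `m` is a power of two. -/
theorem le_sqrt_mul_sum_of_subadditive (ha0 : ∀ n, 0 ≤ a n) (ha : ∀ m n, a m ≤ a n + a (n + m))
    {m : ℕ} (hm : 1 ≤ m) :
    a m ≤ 8 * √m * ∑ n ∈ Finset.Ico m (4 * m), a n / (n : ℝ) ^ (3 / 2 : ℝ) := by
  have hm0 : (0 : ℝ) < m := by exact_mod_cast hm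
  have h1 : (m : ℝ) * a m ≤ ∑ n ∈ Finset.Ico m (4 * m), a n := by
    have h2 : ∑ n ∈ Finset.Ico m (2 * m), a m ≤ ∑ n ∈ Finset.Ico m (2 * m), (a n + a (n + m)) :=
      Finset.sum_le_sum fun n _ => ha m n
    rw [Finset.sum_const, Nat.card_Ico, nsmul_eq_mul, Finset.sum_add_distrib,
      Finset.sum_Ico_add' a m (2 * m) m, show 2 * m - m = m by omega, ← two_mul] at h2
    refine h2.trans ?_
    rw [Finset.sum_Ico_consecutive a (by omega) (by omega)]
    exact Finset.sum_le_sum_of_subset_of_nonneg (Finset.Ico_subset_Ico_right (by omega))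
      fun n _ _ => ha0 n
  have h3 : ∀ n ∈ Finset.Ico m (4 * m),
      a n ≤ 8 * (m * √m) * (a n / (n : ℝ) ^ (3 / 2 : ℝ)) := by
    intro n hn
    rw [Finset.mem_Ico] at hn
    have hn0 : (0 : ℝ) < n := by
      have : 0 < n := by omega
      exact_mod_cast this
    have hn4 : (n : ℝ) ≤ 4 * m := by exact_mod_cast hn.2.le
    have h4 : (n : ℝ) ^ (3 / 2 : ℝ) ≤ 8 * (m * √m) := by
      calc (n : ℝ) ^ (3 / 2 : ℝ) ≤ (4 * m : ℝ) ^ (3 / 2 : ℝ) :=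
            Real.rpow_le_rpow hn0.le hn4 (by norm_num)
        _ = 8 * (m * √m) := by
            rw [show (3 / 2 : ℝ) = 1 + 1 / 2 by norm_num, Real.rpow_add (by positivity),
              Real.rpow_one, ← Real.sqrt_eq_rpow, Real.sqrt_mul (by norm_num),
              show (4 : ℝ) = 2 ^ 2 by norm_num, Real.sqrt_sq (by norm_num)]
            ring
    rw [mul_div_assoc', le_div_iff₀ (by positivity), mul_comm]
    exact mul_le_mul_of_nonneg_right h4 (ha0 n)
  have h5 := h1.trans (Finset.sum_le_sum h3)
  rw [← Finset.mul_sum] at h5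
  refine le_of_mul_le_mul_left (h5.trans (le_of_eq ?_)) hm0
  ring

/-- Each dyadic term is controlled by two adjacent blocks, so every block is used at most twice: `16
= 2 * 8`. -/
theorem sum_dyadic_le_tail (ha0 : ∀ n, 0 ≤ a n) (ha : ∀ m n, a m ≤ a n + a (n + m))
    (hs : Summable fun n : ℕ => a n / (n : ℝ) ^ (3 / 2 : ℝ)) (J N : ℕ) :
    ∑ i ∈ Finset.range N, a (2 ^ (i + J)) / √(2 ^ (i + J))
      ≤ 16 * ∑' j : ℕ, a (2 ^ J + j) / ((2 ^ J + j : ℕ) : ℝ) ^ (3 / 2 : ℝ) := by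
  set c : ℕ → ℝ := fun n => a n / (n : ℝ) ^ (3 / 2 : ℝ) with hc
  have hc0 : ∀ n, 0 ≤ c n := fun n => div_nonneg (ha0 n) (by positivity)
  have hI : ∀ n : ℕ, ∑ k ∈ Finset.Ico (2 ^ J) n, c k ≤ ∑' j, c (2 ^ J + j) := by
    intro n
    rw [Finset.sum_Ico_eq_sum_range]
    refine Summable.sum_le_tsum _ (fun j _ => hc0 _) ?_
    simpa only [add_comm] using (summable_nat_add_iff (2 ^ J)).2 hs
  have h1 : ∀ i, a (2 ^ i) / √(2 ^ i)
      ≤ 8 * (∑ n ∈ Finset.Ico (2 ^ i) (2 ^ (i + 1)), c n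
        + ∑ n ∈ Finset.Ico (2 ^ (i + 1)) (2 ^ (i + 1 + 1)), c n) := by
    intro i
    have h2 := le_sqrt_mul_sum_of_subadditive ha0 ha (m := 2 ^ i) Nat.one_le_two_pow
    rw [Finset.sum_Ico_consecutive c (Nat.pow_le_pow_right two_pos (Nat.le_succ _))
      (Nat.pow_le_pow_right two_pos (Nat.le_succ _)), div_le_iff₀ (by positivity)]
    rw [show 4 * 2 ^ i = 2 ^ (i + 1 + 1) by ring] at h2
    push_cast at h2
    linarith
  have hblock : ∀ M N, ∑ i ∈ Finset.range N, ∑ n ∈ Finset.Ico (2 ^ (i + M)) (2 ^ (i + M + 1)), c n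
      = ∑ n ∈ Finset.Ico (2 ^ M) (2 ^ (N + M)), c n := by
    intro M N
    induction N with
    | zero => simp
    | succ N ih =>
      rw [Finset.sum_range_succ, ih, add_right_comm N 1 M, Finset.sum_Ico_consecutive c
        (Nat.pow_le_pow_right two_pos (Nat.le_add_left _ _))
        (Nat.pow_le_pow_right two_pos (Nat.le_succ _))]
  calc ∑ i ∈ Finset.range N, a (2 ^ (i + J)) / √(2 ^ (i + J))
      ≤ ∑ i ∈ Finset.range N, 8 * (∑ n ∈ Finset.Ico (2 ^ (i + J)) (2 ^ (i + J + 1)), c n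
        + ∑ n ∈ Finset.Ico (2 ^ (i + (J + 1))) (2 ^ (i + (J + 1) + 1)), c n) :=
        Finset.sum_le_sum fun i _ => h1 (i + J)
    _ = 8 * (∑ n ∈ Finset.Ico (2 ^ J) (2 ^ (N + J)), c n
        + ∑ n ∈ Finset.Ico (2 ^ (J + 1)) (2 ^ (N + (J + 1))), c n) := by
        rw [← Finset.mul_sum, Finset.sum_add_distrib, hblock, hblock]
    _ ≤ 8 * (∑' j, c (2 ^ J + j) + ∑' j, c (2 ^ J + j)) := by
        gcongr
        · exact hI _
        · refine le_trans (Finset.sum_le_sum_of_subset_of_nonneg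
            (Finset.Ico_subset_Ico_left ?_) fun n _ _ => hc0 n) (hI _)
          exact Nat.pow_le_pow_right two_pos (Nat.le_succ _)
    _ = _ := by ring

/-- The weighted condition on `a n = ‖E(S_n | F_0)‖` gives a summable dyadic mean square rate. -/
theorem AdmissibleWeights.exists_dyadic_weights (hb : AdmissibleWeights b) (ha0 : ∀ n, 0 ≤ a n)
    (ha : ∀ m n, a m ≤ a n + a (n + m))
    (hs : Summable fun n : ℕ => a n / (n : ℝ) ^ (3 / 2 : ℝ))
    (hsum : Summable fun n : ℕ => b (n + 1) / ((n + 1 : ℕ) : ℝ)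
      * (∑' j : ℕ, a (n + 1 + j) / ((n + 1 + j : ℕ) : ℝ) ^ (3 / 2 : ℝ)) ^ 2) :
    (Summable fun i : ℕ => a (2 ^ i) / √(2 ^ i)) ∧
    ∃ β : ℕ → ℝ, (∀ i, 0 < β i) ∧ (Summable fun i => (β i)⁻¹) ∧
      ∀ r : ℕ → ℝ, (∀ J, 0 ≤ r J) →
        (∀ J, r J ≤ ∑ i ∈ Finset.range J, a (2 ^ i)
          + √(2 ^ J) * (∑' i : ℕ, a (2 ^ (i + J)) / √(2 ^ (i + J))) + a (2 ^ J)) →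
        Summable fun J => β J * ((2 ^ J)⁻¹ * r J ^ 2) := by
  set c : ℕ → ℝ := fun n => a n / (n : ℝ) ^ (3 / 2 : ℝ) with hc
  have hc0 : ∀ n, 0 ≤ c n := fun n => div_nonneg (ha0 n) (by positivity)
  set x : ℕ → ℝ := fun i => a (2 ^ i) / √(2 ^ i) with hx
  have hx0 : ∀ i, 0 ≤ x i := fun i => div_nonneg (ha0 _) (by positivity)
  set q : ℕ → ℝ := fun n => ∑' j, c (n + j) with hq
  have hcs : ∀ n, Summable fun j => c (n + j) := fun n => by
    simpa only [add_comm] using (summable_nat_add_iff n).2 hs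
  have hq0 : ∀ n, 0 ≤ q n := fun n => tsum_nonneg fun j => hc0 _
  have hqm : ∀ m n, 1 ≤ m → m ≤ n → q n ≤ q m := by
    intro m n _ hmn
    obtain ⟨k, rfl⟩ := Nat.exists_eq_add_of_le hmn
    simp only [hq]
    rw [← (hcs m).sum_add_tsum_nat_add k]
    simp only [add_assoc, add_comm k]
    exact le_add_of_nonneg_left (Finset.sum_nonneg fun i _ => hc0 _)
  have hxq := sum_dyadic_le_tail ha0 ha hs
  have hxs : Summable x := summable_of_sum_range_le hx0 fun N => hxq 0 N
  set τ : ℕ → ℝ := fun J => ∑' i, x (i + J) with hτ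
  have hxsJ : ∀ J, Summable fun i => x (i + J) := fun J => (summable_nat_add_iff J).2 hxs
  have hτq : ∀ J, τ J ≤ 16 * q (2 ^ J) := fun J =>
    (hxsJ J).tsum_le_of_sum_range_le fun N => hxq J N
  have hτ0 : ∀ J, 0 ≤ τ J := fun J => tsum_nonneg fun i => hx0 _
  have hxτ : ∀ J, x J ≤ τ J := fun J => by
    simpa using (hxsJ J).le_tsum 0 fun i _ => hx0 _
  -- The shift by one matches `summable_dyadic_mul_sq`; at `J = 0` the truncated subtraction gives
  -- `b 1`.
  set β : ℕ → ℝ := fun J => b (2 ^ (J - 1)) with hβ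
  have hβ0 : ∀ J, 0 < β J := fun J => hb.pos _ Nat.one_le_two_pow
  have hβτ : Summable fun J => β J * τ J ^ 2 := by
    have h1 : Summable fun J => β J * q (2 ^ J) ^ 2 := by
      rw [← summable_nat_add_iff 1]
      exact hb.summable_dyadic_mul_sq hq0 hqm hsum
    refine Summable.of_nonneg_of_le (fun J => mul_nonneg (hβ0 J).le (sq_nonneg _)) (fun J => ?_)
      (h1.mul_left 256)
    have h2 : τ J ^ 2 ≤ (16 * q (2 ^ J)) ^ 2 := pow_le_pow_left₀ (hτ0 J) (hτq J) 2
    have h3 := mul_le_mul_of_nonneg_left h2 (hβ0 J).le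
    linarith
  -- The normalised coboundary part satisfies `y_{J+1} = (y_J + x_J) / √2`. Its square thus
  -- contracts by about one half, which beats the slow growth of `β`.
  set y : ℕ → ℝ := fun J => (∑ i ∈ Finset.range J, a (2 ^ i)) / √(2 ^ J) with hy
  have hy1 : ∀ J, y (J + 1) ^ 2 = (y J + x J) ^ 2 / 2 := by
    intro J
    simp only [hy, hx]
    rw [Finset.sum_range_succ, ← add_div, div_pow, div_pow, Real.sq_sqrt (by positivity),
      Real.sq_sqrt (by positivity), pow_succ (2 : ℝ), div_div]
  have hys : Summable fun J => β J * y J ^ 2 := by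
    -- `27/32 = 3/2 * 9/8 * 1/2`: growth of `β`, Young's inequality, and the halving; likewise `27/4
    -- = 3/2 * 9 * 1/2`.
    refine summable_of_contraction (ρ := 27 / 32) (by norm_num)
      (fun J => mul_nonneg (hβ0 J).le (sq_nonneg _)) (hβτ.mul_left (27 / 4))
      (fun J => mul_nonneg (by norm_num) (mul_nonneg (hβ0 J).le (sq_nonneg _))) ?_
    have h1 : ∀ᶠ J in atTop, β (J + 1) ≤ 3 / 2 * β J := by
      obtain ⟨N, hN⟩ := eventually_atTop.1 hb.eventually_dyadic_le
      filter_upwards [eventually_ge_atTop (N + 1)] with J hJ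
      have := hN (J - 1) (by omega)
      rwa [Nat.sub_add_cancel (by omega)] at this
    filter_upwards [h1] with J hJ
    have h2 : (y J + x J) ^ 2 ≤ 9 / 8 * y J ^ 2 + 9 * τ J ^ 2 := by
      have h3 : x J ^ 2 ≤ τ J ^ 2 := pow_le_pow_left₀ (hx0 J) (hxτ J) 2
      nlinarith [sq_nonneg (y J - 8 * x J)]
    rw [hy1]
    calc β (J + 1) * ((y J + x J) ^ 2 / 2)
        ≤ (3 / 2 * β J) * ((9 / 8 * y J ^ 2 + 9 * τ J ^ 2) / 2) := by
          have := (hβ0 J).le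
          gcongr
      _ = _ := by ring
  refine ⟨hxs, β, hβ0, ?_, fun r hr0 hr => ?_⟩
  · rw [← summable_nat_add_iff 1]
    exact hb.summable_inv_dyadic
  · refine Summable.of_nonneg_of_le (fun J => mul_nonneg (hβ0 J).le (by positivity)) (fun J => ?_)
      ((hys.mul_left 2).add (hβτ.mul_left 8))
    have hsq : (0 : ℝ) < √(2 ^ J) := by positivity
    have h1 : r J / √(2 ^ J) ≤ y J + τ J + x J := by
      rw [div_le_iff₀ hsq]
      refine (hr J).trans (le_of_eq ?_)
      simp only [hy, hx, hτ]
      field_simp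
    have h2 : r J / √(2 ^ J) ≤ y J + 2 * τ J := by linarith [hxτ J]
    have h3 : (2 ^ J)⁻¹ * r J ^ 2 ≤ 2 * y J ^ 2 + 8 * τ J ^ 2 := by
      have h4 := pow_le_pow_left₀ (div_nonneg (hr0 J) hsq.le) h2 2
      rw [div_pow, Real.sq_sqrt (by positivity), div_eq_inv_mul] at h4
      nlinarith [sq_nonneg (y J - 2 * τ J)]
    have h5 := mul_le_mul_of_nonneg_left h3 (hβ0 J).le
    linarith

end Rates

/-! ### The logarithmic weights -/

section LogWeights

theorem one_lt_log_of_three_le {x : ℝ} (hx : 3 ≤ x) : 1 < Real.log x := by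
  rw [Real.lt_log_iff_exp_lt (by linarith)]
  linarith [Real.exp_one_lt_d9]

theorem log₂_of_three_le {x : ℝ} (hx : 3 ≤ x) : log₂ x = Real.log (Real.log x) := by
  rw [log₂, max_eq_right]
  linarith [Real.exp_one_lt_d9]

theorem three_le_natCast_max (n : ℕ) : (3 : ℝ) ≤ ((max n 3 : ℕ) : ℝ) := by
  exact_mod_cast le_max_right n 3

theorem logWeights_eq (γ : ℝ) (n : ℕ) : logWeights γ n
    = Real.log ((max n 3 : ℕ) : ℝ) * Real.log (Real.log ((max n 3 : ℕ) : ℝ)) ^ γ := by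
  rw [logWeights, log₂_of_three_le (three_le_natCast_max n)]

theorem logWeights_pos (γ : ℝ) (n : ℕ) : 0 < logWeights γ n := by
  have h := one_lt_log_of_three_le (three_le_natCast_max n)
  rw [logWeights_eq]
  exact mul_pos (by linarith) (Real.rpow_pos_of_pos (Real.log_pos h) _)

theorem logWeights_mono {γ : ℝ} (hγ : 0 ≤ γ) : Monotone (logWeights γ) := by
  intro m n hmn
  have h := one_lt_log_of_three_le (three_le_natCast_max m)
  have h3 := three_le_natCast_max m
  have hle : ((max m 3 : ℕ) : ℝ) ≤ ((max n 3 : ℕ) : ℝ) := by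
    exact_mod_cast max_le_max hmn le_rfl
  have h1 := Real.log_le_log (by linarith) hle
  have h2 := Real.log_le_log (by linarith) h1
  rw [logWeights_eq, logWeights_eq]
  exact mul_le_mul h1 (Real.rpow_le_rpow (Real.log_pos h).le h2 hγ)
    (Real.rpow_nonneg (Real.log_pos h).le _) (by linarith)

/-- `log u = log v + log (u / v)`, and the last term stays bounded. Used once for the logarithm and
again for its iterate. -/
theorem tendsto_log_div_log {u v : ℕ → ℝ} {c : ℝ} (hc : 0 < c) (hv : Tendsto v atTop atTop)
    (huv : Tendsto (fun n => u n / v n) atTop (𝓝 c)) :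
    Tendsto (fun n => Real.log (u n) / Real.log (v n)) atTop (𝓝 1) := by
  have h1 : Tendsto (fun n => 1 + Real.log (u n / v n) / Real.log (v n)) atTop (𝓝 (1 + 0)) :=
    tendsto_const_nhds.add (((Real.continuousAt_log hc.ne').tendsto.comp huv).div_atTop
      (Real.tendsto_log_atTop.comp hv))
  rw [add_zero] at h1
  refine h1.congr' ?_
  filter_upwards [huv.eventually_const_lt hc, hv.eventually_gt_atTop 1] with n h2 h3
  have hv0 : 0 < v n := by linarith
  have hu0 : 0 < u n := by
    have := mul_pos h2 hv0
    rwa [div_mul_cancel₀ _ hv0.ne'] at this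
  have hl : 0 < Real.log (v n) := Real.log_pos h3
  rw [Real.log_div hu0.ne' hv0.ne']
  field_simp
  ring

theorem slowlyVarying_logWeights (γ : ℝ) : SlowlyVarying (logWeights γ) := by
  intro l hl
  set v : ℕ → ℝ := fun n => ((max n 3 : ℕ) : ℝ) with hv
  set u : ℕ → ℝ := fun n => ((max ⌊l * (n : ℝ)⌋₊ 3 : ℕ) : ℝ) with hu
  have hvt : Tendsto v atTop atTop :=
    tendsto_natCast_atTop_atTop.comp (tendsto_atTop_mono (fun n => le_max_left n 3) tendsto_id)
  have huv : Tendsto (fun n => u n / v n) atTop (𝓝 l) := by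
    have h1 := (tendsto_nat_floor_mul_div_atTop hl.le).comp
      (tendsto_natCast_atTop_atTop (R := ℝ))
    refine h1.congr' ?_
    have h2 : Tendsto (fun n : ℕ => ⌊l * (n : ℝ)⌋₊) atTop atTop :=
      tendsto_nat_floor_atTop.comp (tendsto_natCast_atTop_atTop.const_mul_atTop hl)
    filter_upwards [eventually_ge_atTop 3, h2.eventually_ge_atTop 3] with n hn hn'
    simp only [hu, hv, Function.comp, max_eq_left hn, max_eq_left hn']
  have hlog := tendsto_log_div_log hl hvt huv
  have hlog2 := tendsto_log_div_log one_pos (Real.tendsto_log_atTop.comp hvt) hlog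
  have hpow := hlog2.rpow_const (p := γ) (Or.inl one_ne_zero)
  have hmul := hlog.mul hpow
  rw [Real.one_rpow, mul_one] at hmul
  refine hmul.congr fun n => ?_
  have h1 := Real.log_pos (one_lt_log_of_three_le (three_le_natCast_max n))
  have h2 := Real.log_pos (one_lt_log_of_three_le (three_le_natCast_max ⌊l * (n : ℝ)⌋₊))
  rw [logWeights_eq, logWeights_eq, mul_div_mul_comm, ← Real.div_rpow h2.le h1.le]
  rfl

/-- Cauchy condensation applied twice reduces the series to `∑ k^{-γ}`. -/
theorem summable_inv_logWeights {γ : ℝ} (hγ : 1 < γ) :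
    Summable fun n : ℕ => ((n : ℝ) * logWeights γ n)⁻¹ := by
  have hγ0 : 0 ≤ γ := by linarith
  have hp := logWeights_pos γ
  have hm := logWeights_mono hγ0
  refine (summable_condensed_iff_of_nonneg (fun n => ?_) fun m n h0 hmn => ?_).1 ?_
  · have := hp n
    positivity
  · have h1 := hp m
    have h2 := hm hmn
    have : (0 : ℝ) < m := by exact_mod_cast h0
    gcongr
  have h1 : ∀ k : ℕ, (2 : ℝ) ^ k * (((2 ^ k : ℕ) : ℝ) * logWeights γ (2 ^ k))⁻¹
      = (logWeights γ (2 ^ k))⁻¹ := by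
    intro k
    push_cast
    rw [mul_inv, mul_inv_cancel_left₀ (by positivity)]
  simp only [h1]
  refine (summable_condensed_iff_of_nonneg (f := fun k => (logWeights γ (2 ^ k))⁻¹)
    (fun n => (inv_pos.2 (hp _)).le) fun m n h0 hmn => ?_).1 ?_
  · have h2 := hp (2 ^ m)
    have h3 := hm (Nat.pow_le_pow_right two_pos hmn)
    gcongr
  have hl2 : 1 / 2 < Real.log 2 := by linarith [Real.log_two_gt_d9]
  have hl0 : 0 < Real.log 2 := by linarith
  have hll : -Real.log 2 ≤ Real.log (Real.log 2) := by
    rw [← Real.log_inv]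
    exact Real.log_le_log (by norm_num) (by linarith)
  rw [← summable_nat_add_iff 2]
  refine Summable.of_nonneg_of_le (fun k => mul_nonneg (by positivity) (inv_pos.2 (hp _)).le)
    (fun k => ?_) (((summable_nat_add_iff 2).2 (Real.summable_nat_rpow_inv.2 hγ)).mul_left
      ((Real.log 2)⁻¹ * ((Real.log 2 / 2) ^ γ)⁻¹))
  have h3 : 3 ≤ 2 ^ (2 ^ (k + 2)) := by
    have h4 : 2 ^ 1 ≤ 2 ^ (k + 2) := Nat.pow_le_pow_right two_pos (by omega)
    have h5 : 2 ^ (2 ^ 1) ≤ 2 ^ (2 ^ (k + 2)) := Nat.pow_le_pow_right two_pos h4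
    omega
  have h4 : Real.log (((2 ^ (2 ^ (k + 2)) : ℕ)) : ℝ) = 2 ^ (k + 2) * Real.log 2 := by
    push_cast
    rw [Real.log_pow]
    push_cast
    rfl
  have h5 : Real.log (2 ^ (k + 2) * Real.log 2)
      = ((k + 2 : ℕ) : ℝ) * Real.log 2 + Real.log (Real.log 2) := by
    rw [Real.log_mul (by positivity) hl0.ne', Real.log_pow]
  have h6 : Real.log 2 / 2 * ((k + 2 : ℕ) : ℝ)
      ≤ ((k + 2 : ℕ) : ℝ) * Real.log 2 + Real.log (Real.log 2) := by
    push_cast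
    have : 0 ≤ (k : ℝ) * Real.log 2 := by positivity
    linarith
  rw [logWeights_eq, max_eq_left h3, h4, h5, mul_assoc ((2 : ℝ) ^ (k + 2)), mul_inv,
    mul_inv_cancel_left₀ (by positivity), mul_inv, mul_assoc (Real.log 2)⁻¹,
    ← mul_inv ((Real.log 2 / 2) ^ γ), ← Real.mul_rpow (by positivity) (by positivity)]
  gcongr

theorem admissibleWeights_logWeights {γ : ℝ} (hγ : 1 < γ) : AdmissibleWeights (logWeights γ) where
  pos n _ := logWeights_pos γ n
  nondecreasing _ _ _ hmn := logWeights_mono (by linarith) hmn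
  slowlyVarying := slowlyVarying_logWeights γ
  summable := (summable_nat_add_iff 1).2 (summable_inv_logWeights hγ)

end LogWeights

/-! ### Conditional expectations and martingale differences -/

section CondExp

/-- Conditional expectations commute with measure preserving maps. -/
theorem condExp_comp_measurePreserving {Ω Ω' : Type*} {m' : MeasurableSpace Ω'}
    [mΩ : MeasurableSpace Ω] [mΩ' : MeasurableSpace Ω'] {P : Measure Ω} {P' : Measure Ω'}
    [IsFiniteMeasure P] {φ : Ω → Ω'} (hφ : MeasurePreserving φ P P') (hm : m' ≤ mΩ')
    {f : Ω' → ℝ} (hf : Integrable f P') :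
    P[f ∘ φ | m'.comap φ] =ᵐ[P] P'[f | m'] ∘ φ := by
  have hP' : IsFiniteMeasure P' := by
    rw [← hφ.map_eq]; infer_instance
  have hm2 : m'.comap φ ≤ mΩ := (MeasurableSpace.comap_mono hm).trans hφ.measurable.comap_le
  have hset : ∀ {g : Ω' → ℝ}, Integrable g P' → ∀ t, MeasurableSet[m'] t →
      ∫ ω in φ ⁻¹' t, g (φ ω) ∂P = ∫ ω in t, g ω ∂P' := by
    intro g hg t ht
    have := hg.aestronglyMeasurable
    rw [← hφ.map_eq] at this ⊢
    exact (setIntegral_map (hm t ht) this hφ.measurable.aemeasurable).symm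
  refine (ae_eq_condExp_of_forall_setIntegral_eq hm2
    (hφ.integrable_comp_of_integrable hf) (fun s _ _ => ?_) ?_ ?_).symm
  · exact (hφ.integrable_comp_of_integrable integrable_condExp).integrableOn
  · rintro s ⟨t, ht, rfl⟩ -
    refine (hset integrable_condExp t ht).trans ?_
    rw [setIntegral_condExp hm hf ht]
    exact (hset hf t ht).symm
  · exact (stronglyMeasurable_condExp.comp_measurable
      (comap_measurable φ)).aestronglyMeasurable

/-- Partial sums of a martingale difference sequence form a martingale. -/
theorem martingale_partialSum {Ω : Type*} {mΩ : MeasurableSpace Ω} {P : Measure Ω}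
    [IsProbabilityMeasure P] {F : Filtration ℤ mΩ} {D : ℤ → Ω → ℝ}
    (hL : ∀ k : ℤ, MemLp (D k) 2 P) (hD : ∀ k : ℤ, StronglyMeasurable[F (k + 1)] (D k))
    (hc : ∀ k : ℤ, P[D k | F k] =ᵐ[P] 0) : Martingale (partialSum D) (natFiltration F) P := by
  refine martingale_of_condExp_sub_eq_zero_nat (fun n => ?_) (fun n => ?_) fun n => ?_
  · refine Finset.stronglyMeasurable_fun_sum _ fun i hi => (hD i).mono (F.mono ?_)
    have := Finset.mem_range.1 hi
    omega
  · exact integrable_finsetSum _ fun i _ => (hL i).integrable one_le_two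
  · have : partialSum D (n + 1) - partialSum D n = D n := by
      funext ω
      simp [partialSum, Finset.sum_range_succ]
    rw [this]
    exact hc n

end CondExp

/-! ### Iterates of the transformation -/

section Iterates

variable {Ω : Type*} [MeasurableSpace Ω] {P : Measure Ω} {T : Ω ≃ᵐ Ω}

theorem iter_zero (T : Ω ≃ᵐ Ω) : iter T 0 = id := by
  simp only [iter, zpow_zero]; rfl

theorem iter_add (T : Ω ≃ᵐ Ω) (i j : ℤ) : iter T (i + j) = iter T i ∘ iter T j := by
  simp only [iter, zpow_add]; rfl

theorem iter_natCast (T : Ω ≃ᵐ Ω) (n : ℕ) : iter T n = T^[n] := by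
  simp only [iter, zpow_natCast]
  exact (Equiv.Perm.iterate_eq_pow _ _).symm

theorem measurePreserving_iter (hT : MeasurePreserving T P P) (i : ℤ) :
    MeasurePreserving (iter T i) P P := by
  induction i using Int.induction_on with
  | zero => rw [iter_zero]; exact MeasurePreserving.id P
  | succ n ih => rw [iter_add_one]; exact hT.comp ih
  | pred n ih =>
    have h : iter T (-(n : ℤ)) = T ∘ iter T (-(n : ℤ) - 1) := by
      rw [← iter_add_one, sub_add_cancel]
    have h2 : iter T (-(n : ℤ) - 1) = T.symm ∘ iter T (-(n : ℤ)) := by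
      rw [h]; funext ω; simp
    rw [h2]; exact (hT.symm T).comp ih

theorem partialSum_iter (f : Ω → ℝ) (n : ℕ) :
    partialSum (fun i ω => f (iter T i ω)) n = birkhoffSum T f n := by
  funext ω
  simp only [partialSum, birkhoffSum, iter_natCast]

theorem isStationary_iter (hT : MeasurePreserving T P P) {f : Ω → ℝ} (hf : Measurable f) :
    IsStationary (fun k ω => f (iter T k ω)) P := by
  intro k
  have hm : Measurable fun ω (i : ℤ) => f (iter T i ω) :=
    measurable_pi_lambda _ fun i => hf.comp (measurable_iter T i)
  have hk : (fun ω (i : ℤ) => f (iter T (i + k) ω))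
      = (fun ω (i : ℤ) => f (iter T i ω)) ∘ iter T k := by
    funext ω i
    simp only [iter_add, Function.comp]
  refine ⟨?_, hm.aemeasurable, ?_⟩
  · rw [hk]; exact (hm.comp (measurable_iter T k)).aemeasurable
  · rw [hk, ← Measure.map_map hm (measurable_iter T k), (measurePreserving_iter hT k).map_eq]

end Iterates

/-! ### The Koopman operator and the subspace of `F₀`-measurable functions -/

section Koopman

variable {Ω : Type*} {F₀ : MeasurableSpace Ω} [mΩ : MeasurableSpace Ω] {P : Measure Ω}

/-- The Koopman operator on `L²`. -/
noncomputable abbrev koopman {T : Ω → Ω} (hT : MeasurePreserving T P P) :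
    Lp ℝ 2 P →ₗᵢ[ℝ] Lp ℝ 2 P :=
  Lp.compMeasurePreservingₗᵢ ℝ T hT

theorem coeFn_koopman {T : Ω → Ω} (hT : MeasurePreserving T P P) (f : Lp ℝ 2 P) :
    koopman hT f =ᵐ[P] f ∘ T :=
  Lp.coeFn_compMeasurePreserving f hT

theorem coeFn_powerSum_koopman {T : Ω → Ω} (hT : MeasurePreserving T P P) {z : Lp ℝ 2 P}
    {f : Ω → ℝ} (hz : z =ᵐ[P] f) (n : ℕ) :
    powerSum (koopman hT).toContinuousLinearMap n z =ᵐ[P] birkhoffSum T f n := by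
  induction n with
  | zero =>
    simp only [powerSum, Finset.range_zero, Finset.sum_empty, birkhoffSum_zero']
    exact Lp.coeFn_zero _ _ _
  | succ n ih =>
    have h1 : powerSum (koopman hT).toContinuousLinearMap (n + 1) z
        = z + koopman hT (powerSum (koopman hT).toContinuousLinearMap n z) := by
      rw [add_comm, powerSum_add]
      simp [powerSum]
    rw [h1]
    filter_upwards [Lp.coeFn_add z (koopman hT (powerSum (koopman hT).toContinuousLinearMap n z)),
      coeFn_koopman hT (powerSum (koopman hT).toContinuousLinearMap n z), hz,
      hT.quasiMeasurePreserving.ae_eq_comp ih] with ω h2 h3 h4 h5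
    rw [h2, Pi.add_apply, h3, h4, h5, birkhoffSum_succ']
    rfl

theorem norm_sq_eq_integral_of_ae_eq {z : Lp ℝ 2 P} {f : Ω → ℝ} (hz : z =ᵐ[P] f) :
    ‖z‖ ^ 2 = ∫ ω, f ω ^ 2 ∂P := by
  rw [← real_inner_self_eq_norm_sq, L2.inner_def]
  refine integral_congr_ae ?_
  filter_upwards [hz] with ω h
  rw [real_inner_self_eq_norm_sq, h, Real.norm_eq_abs, sq_abs]

theorem hasOrthogonalProjection_lpMeas (hF : F₀ ≤ mΩ) :
    (lpMeas ℝ ℝ F₀ 2 P).HasOrthogonalProjection := by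
  have : Fact (F₀ ≤ mΩ) := ⟨hF⟩
  infer_instance

theorem coeFn_starProjection_lpMeas [IsFiniteMeasure P] (hF : F₀ ≤ mΩ)
    [(lpMeas ℝ ℝ F₀ 2 P).HasOrthogonalProjection] {z : Lp ℝ 2 P} {f : Ω → ℝ} (hz : z =ᵐ[P] f) :
    (lpMeas ℝ ℝ F₀ 2 P).starProjection z =ᵐ[P] P[f | F₀] := by
  have h1 : MemLp f 2 P := (memLp_congr_ae hz).1 (Lp.memLp z)
  have h2 : h1.toLp f = z := Lp.ext (h1.coeFn_toLp.trans hz.symm)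
  have h3 := h1.condExpL2_ae_eq_condExp (𝕜 := ℝ) hF
  rw [h2] at h3
  exact h3

/-- The preimage of `z` is `z ∘ T⁻¹`: an `F₀`-measurable `z` is `T⁻¹(F₀)`-measurable, and composing
with `T⁻¹` brings it back to `F₀`. -/
theorem lpMeas_le_map_koopman {T : Ω ≃ᵐ Ω} (hT : MeasurePreserving T P P) (hF : F₀ ≤ F₀.comap T) :
    lpMeas ℝ ℝ F₀ 2 P ≤ (lpMeas ℝ ℝ F₀ 2 P).map (koopman hT).toLinearMap := by
  intro z hz
  obtain ⟨g, hg, hzg⟩ := mem_lpMeas_iff_aestronglyMeasurable.1 hz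
  have hT' : MeasurePreserving T.symm P P := hT.symm T
  have hsymm : Measurable[F₀, F₀.comap T] T.symm := by
    rintro s ⟨t, ht, rfl⟩
    have : T.symm ⁻¹' (T ⁻¹' t) = t := by ext ω; simp
    rwa [this]
  refine ⟨koopman hT' z, mem_lpMeas_iff_aestronglyMeasurable.2 ⟨g ∘ T.symm, ?_, ?_⟩, ?_⟩
  · exact (hg.mono hF).comp_measurable hsymm
  · exact (coeFn_koopman hT' z).trans (hT'.quasiMeasurePreserving.ae_eq_comp hzg)
  · refine Lp.ext ((coeFn_koopman hT _).trans ?_)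
    filter_upwards [hT.quasiMeasurePreserving.ae_eq_comp (coeFn_koopman hT' z)] with ω hω
    rw [hω]
    simp

end Koopman

/-! ### The case of a measure preserving transformation -/

section Transformation

/-- The real form of the condition on the norms of the projected partial sums. -/
theorem SlowCondition.summable {Ω : Type*} {mΩ : MeasurableSpace Ω} {P : Measure Ω}
    {F : Filtration ℤ mΩ} {X : ℤ → Ω → ℝ} {a b : ℕ → ℝ} (h : SlowCondition P F X b)
    (hb : AdmissibleWeights b) (ha0 : ∀ n, 0 ≤ a n)
    (ha : ∀ n, eLpNorm (P[partialSum X n | F 0]) 2 P = ENNReal.ofReal (a n)) :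
    (Summable fun n : ℕ => a n / (n : ℝ) ^ (3 / 2 : ℝ)) ∧
    Summable fun n : ℕ => b (n + 1) / ((n + 1 : ℕ) : ℝ)
      * (∑' j : ℕ, a (n + 1 + j) / ((n + 1 + j : ℕ) : ℝ) ^ (3 / 2 : ℝ)) ^ 2 := by
  have hb0 : ∀ n : ℕ, 0 < b (n + 1) / ((n + 1 : ℕ) : ℝ) := fun n =>
    div_pos (hb.pos _ (Nat.le_add_left _ _)) (by positivity)
  have hc0 : ∀ n : ℕ, 0 ≤ a n / (n : ℝ) ^ (3 / 2 : ℝ) := fun n =>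
    div_nonneg (ha0 n) (by positivity)
  have hproj : ∀ n : ℕ, projTail P F X (n + 1)
      = ∑' j : ℕ, ENNReal.ofReal (a (n + 1 + j) / ((n + 1 + j : ℕ) : ℝ) ^ (3 / 2 : ℝ)) := by
    intro n
    refine tsum_congr fun j => ?_
    have : 0 < ((n + 1 + j : ℕ) : ℝ) := by
      have : 0 < n + 1 + j := by omega
      exact_mod_cast this
    rw [ha, ENNReal.ofReal_div_of_pos (by positivity)]
  -- The term `n = 1` of the outer sum has a positive weight, so its inner tail is finite; this
  -- gives the unweighted summability that defines the martingale.
  have h1 : projTail P F X (0 + 1) ≠ ∞ := by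
    intro htop
    have h2 := ENNReal.le_tsum (f := fun n : ℕ =>
      ENNReal.ofReal (b (n + 1) / ((n + 1 : ℕ) : ℝ)) * projTail P F X (n + 1) ^ 2) 0
    have h3 : ENNReal.ofReal (b (0 + 1) / ((0 + 1 : ℕ) : ℝ)) ≠ 0 := by
      simpa using hb0 0
    simp only [htop] at h2
    rw [ENNReal.top_pow two_ne_zero, ENNReal.mul_top h3] at h2
    exact (lt_of_le_of_lt h2 h).ne rfl
  have hs : Summable fun n : ℕ => a n / (n : ℝ) ^ (3 / 2 : ℝ) := by
    rw [hproj] at h1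
    rw [← summable_nat_add_iff 1]
    refine (ENNReal.summable_toReal h1).congr fun j => ?_
    rw [ENNReal.toReal_ofReal (hc0 _), show 0 + 1 + j = j + 1 by omega]
  refine ⟨hs, ?_⟩
  have h2 : ∑' n : ℕ, ENNReal.ofReal (b (n + 1) / ((n + 1 : ℕ) : ℝ))
      * projTail P F X (n + 1) ^ 2 ≠ ∞ := (show _ < ∞ from h).ne
  refine (ENNReal.summable_toReal h2).congr fun n => ?_
  have h3 : Summable fun j : ℕ => a (n + 1 + j) / ((n + 1 + j : ℕ) : ℝ) ^ (3 / 2 : ℝ) := by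
    simpa only [add_comm] using (summable_nat_add_iff (n + 1)).2 hs
  rw [ENNReal.toReal_mul, ENNReal.toReal_pow, ENNReal.toReal_ofReal (hb0 n).le, hproj,
    ← ENNReal.ofReal_tsum_of_nonneg (fun j => hc0 _) h3,
    ENNReal.toReal_ofReal (tsum_nonneg fun j => hc0 _)]

theorem exists_approx_of_measurePreserving {b : ℕ → ℝ} (hb : AdmissibleWeights b) {Ω : Type*}
    (F₀ : MeasurableSpace Ω) [mΩ : MeasurableSpace Ω] (P : Measure Ω) [IsProbabilityMeasure P]
    (T : Ω ≃ᵐ Ω) (hTP : MeasurePreserving T P P) (hF₀ : F₀ ≤ mΩ) (hT : F₀ ≤ F₀.comap T)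
    (X₀ : Ω → ℝ) (hX₀ : Measurable[F₀] X₀) (hX₀L : MemLp X₀ 2 P)
    (hslow : SlowCondition P (shiftFiltration F₀ T hF₀ hT) (fun i ω => X₀ (iter T i ω)) b) :
    ∃ D₀ : Ω → ℝ, IsASMartingaleApprox P (shiftFiltration F₀ T hF₀ hT)
      (fun i ω => X₀ (iter T i ω)) (fun k ω => D₀ (iter T k ω)) := by
  have := hasOrthogonalProjection_lpMeas (P := P) hF₀
  set K := lpMeas ℝ ℝ F₀ 2 P with hKdef
  set U := koopman hTP
  have hK : K ≤ K.map U.toLinearMap := lpMeas_le_map_koopman hTP hT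
  set x : Lp ℝ 2 P := hX₀L.toLp X₀
  have hxX : x =ᵐ[P] X₀ := hX₀L.coeFn_toLp
  have hxK : x ∈ K := mem_lpMeas_iff_aestronglyMeasurable.2 ⟨X₀, hX₀.stronglyMeasurable, hxX⟩
  set a : ℕ → ℝ := fun n => ‖powerSum (compression U K) n x‖
  have ha0 : ∀ n, 0 ≤ a n := fun n => norm_nonneg _
  have ha : ∀ m n, a m ≤ a n + a (n + m) := fun m n =>
    norm_powerSum_le_add (norm_compression_apply_le U K) m n x
  have hF0 : shiftFiltration F₀ T hF₀ hT 0 = F₀ := by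
    change F₀.comap (iter T 0) = F₀
    rw [iter_zero, MeasurableSpace.comap_id]
  have haE : ∀ n, eLpNorm (P[partialSum (fun i ω => X₀ (iter T i ω)) n |
      shiftFiltration F₀ T hF₀ hT 0]) 2 P = ENNReal.ofReal (a n) := by
    intro n
    rw [hF0, partialSum_iter, ← eLpNorm_congr_ae (coeFn_starProjection_lpMeas hF₀
      (coeFn_powerSum_koopman hTP hxX n)), starProjection_powerSum U hK hxK, ← Lp.enorm_def,
      ofReal_norm]
  obtain ⟨hs, hsum⟩ := hslow.summable hb ha0 haE
  obtain ⟨hxs, β, hβ0, hβs, hβ⟩ := hb.exists_dyadic_weights ha0 ha hs hsum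
  obtain ⟨d, hdK, hdK', hd⟩ := exists_innovation_approx U hK hxK hxs
  -- `d = U κ` with `κ ∈ K`. An `F₀`-measurable version `g` of `κ` makes `g ∘ T` exactly
  -- `F_1`-measurable, not only up to null sets.
  obtain ⟨κ, hκ, rfl⟩ := hdK
  obtain ⟨g, hg, hκg⟩ := mem_lpMeas_iff_aestronglyMeasurable.1 hκ
  have hdg : U κ =ᵐ[P] g ∘ T :=
    (coeFn_koopman hTP κ).trans (hTP.quasiMeasurePreserving.ae_eq_comp hκg)
  have hDm : Measurable (g ∘ T) := ((hg.mono hF₀).comp_measurable T.measurable).measurable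
  have hDL : MemLp (g ∘ T) 2 P := (memLp_congr_ae hdg).1 (Lp.memLp _)
  have hDk : ∀ k : ℤ, (fun ω => (g ∘ T) (iter T k ω)) = g ∘ iter T (k + 1) := fun k => by
    rw [iter_add_one]; rfl
  have hDkL : ∀ k : ℤ, MemLp (fun ω => (g ∘ T) (iter T k ω)) 2 P := fun k =>
    hDL.comp_measurePreserving (measurePreserving_iter hTP k)
  have hDka : ∀ k : ℤ, StronglyMeasurable[shiftFiltration F₀ T hF₀ hT (k + 1)]
      (fun ω => (g ∘ T) (iter T k ω)) := fun k => by
    rw [hDk]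
    exact hg.comp_measurable (comap_measurable _)
  have hD0 : P[g ∘ T | F₀] =ᵐ[P] 0 := by
    refine (coeFn_starProjection_lpMeas hF₀ hdg).symm.trans ?_
    have : K.starProjection (U κ) = 0 := K.starProjection_apply_eq_zero_iff.2 hdK'
    rw [this]
    exact Lp.coeFn_zero _ _ _
  have hDkc : ∀ k : ℤ, P[fun ω => (g ∘ T) (iter T k ω) | shiftFiltration F₀ T hF₀ hT k]
      =ᵐ[P] 0 := fun k =>
    (condExp_comp_measurePreserving (measurePreserving_iter hTP k) hF₀
      (hDL.integrable one_le_two)).trans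
      ((measurePreserving_iter hTP k).quasiMeasurePreserving.ae_eq_comp hD0)
  refine ⟨g ∘ T, isStationary_iter hTP hDm, hDkL, hDka, hDkc,
    martingale_partialSum hDkL hDka hDkc, ?_⟩
  have hYe : (x - U κ : Lp ℝ 2 P) =ᵐ[P] X₀ - g ∘ T :=
    (Lp.coeFn_sub _ _).trans (hxX.sub hdg)
  have hr := hβ (fun J => ‖powerSum U.toContinuousLinearMap (2 ^ J) (x - U κ)‖)
    (fun J => norm_nonneg _) hd
  have hr' : Summable fun J : ℕ =>
      β J * ((2 ^ J)⁻¹ * ∫ ω, birkhoffSum T (X₀ - g ∘ T) (2 ^ J) ω ^ 2 ∂P) :=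
    hr.congr fun J => by
      rw [norm_sq_eq_integral_of_ae_eq (coeFn_powerSum_koopman hTP hYe (2 ^ J))]
  have hX₀m : Measurable X₀ := hX₀.mono hF₀ le_rfl
  filter_upwards [ae_birkhoffSum_isLittleO_sqrt hTP (hX₀m.sub hDm) (hX₀L.sub hDL) hβ0 hβs hr']
    with ω hω
  refine hω.tendsto_div_nhds_zero.congr fun n => ?_
  have h1 := partialSum_iter (T := T) (g ∘ T) n
  rw [h1, partialSum_iter]
  simp only [birkhoffSum, Pi.sub_apply, Finset.sum_sub_distrib]

end Transformation

/-! ### Transfer to path space and stationary chains -/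

section PathSpace

variable {Ω S : Type*} [mΩ : MeasurableSpace Ω] [mS : MeasurableSpace S]

/-- Almost sure martingale approximation can be pulled back along measure preserving maps. -/
theorem IsASMartingaleApprox.comp_measurePreserving {Ω' : Type*} {mΩ' : MeasurableSpace Ω'}
    {P : Measure Ω} [IsProbabilityMeasure P] {μ : Measure Ω'} [IsFiniteMeasure μ] {φ : Ω → Ω'}
    (hφ : MeasurePreserving φ P μ) {F : Filtration ℤ mΩ} {F' : Filtration ℤ mΩ'}
    (hF : ∀ k, (F' k).comap φ = F k) {X : ℤ → Ω → ℝ} {X' D' : ℤ → Ω' → ℝ}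
    (hX : ∀ k, X k =ᵐ[P] X' k ∘ φ) (h : IsASMartingaleApprox μ F' X' D') :
    IsASMartingaleApprox P F X (fun k ω => D' k (φ ω)) := by
  have hL : ∀ k : ℤ, MemLp (fun ω => D' k (φ ω)) 2 P := fun k =>
    (h.memLp k).comp_measurePreserving hφ
  have ha : ∀ k : ℤ, StronglyMeasurable[F (k + 1)] (fun ω => D' k (φ ω)) := fun k => by
    rw [← hF]
    exact (h.adapted k).comp_measurable (comap_measurable φ)
  have hc : ∀ k : ℤ, P[fun ω => D' k (φ ω) | F k] =ᵐ[P] 0 := fun k => by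
    rw [← hF]
    exact (condExp_comp_measurePreserving hφ (F'.le k) ((h.memLp k).integrable one_le_two)).trans
      (hφ.quasiMeasurePreserving.ae_eq_comp (h.condExp_eq_zero k))
  refine ⟨fun k => ?_, hL, ha, hc, martingale_partialSum hL ha hc, ?_⟩
  · have h1 := h.stationary k
    have hm1 := h1.aemeasurable_fst
    have hm2 := h1.aemeasurable_snd
    rw [← hφ.map_eq] at hm1 hm2
    have hmap := h1.map_eq
    rw [← hφ.map_eq, AEMeasurable.map_map_of_aemeasurable hm1 hφ.measurable.aemeasurable,
      AEMeasurable.map_map_of_aemeasurable hm2 hφ.measurable.aemeasurable] at hmap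
    exact ⟨hm1.comp_aemeasurable hφ.measurable.aemeasurable,
      hm2.comp_aemeasurable hφ.measurable.aemeasurable, hmap⟩
  · filter_upwards [ae_all_iff.2 hX, hφ.quasiMeasurePreserving.ae h.tendsto] with ω h1 h2
    refine h2.congr fun n => ?_
    simp only [partialSum, h1, Function.comp]

/-- Conditional expectations commute with `φ`, so the projected partial sums have equal `L²` norms
on both spaces. -/
theorem SlowCondition.of_comp_measurePreserving {Ω' : Type*} {mΩ' : MeasurableSpace Ω'}
    {P : Measure Ω} [IsProbabilityMeasure P] {μ : Measure Ω'} {φ : Ω → Ω'}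
    (hφ : MeasurePreserving φ P μ) {F : Filtration ℤ mΩ} {F' : Filtration ℤ mΩ'}
    (hF : (F' 0).comap φ = F 0) {X : ℤ → Ω → ℝ} {X' : ℤ → Ω' → ℝ}
    (hX : ∀ k, X k =ᵐ[P] X' k ∘ φ) (hX' : ∀ k, Integrable (X' k) μ) {b : ℕ → ℝ}
    (h : SlowCondition P F X b) : SlowCondition μ F' X' b := by
  have hnorm : ∀ n, eLpNorm (μ[partialSum X' n | F' 0]) 2 μ
      = eLpNorm (P[partialSum X n | F 0]) 2 P := by
    intro n
    have hi : Integrable (partialSum X' n) μ := integrable_finsetSum _ fun i _ => hX' i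
    have h1 : partialSum X n =ᵐ[P] partialSum X' n ∘ φ := by
      filter_upwards [ae_all_iff.2 hX] with ω h1
      simp only [partialSum, h1, Function.comp]
    rw [← eLpNorm_comp_measurePreserving integrable_condExp.aestronglyMeasurable hφ, ← hF]
    exact eLpNorm_congr_ae ((condExp_congr_ae h1).trans
      (condExp_comp_measurePreserving hφ (F'.le 0) hi)).symm
  unfold SlowCondition projTail
  simp only [hnorm]
  exact h

/-- The left shift on two-sided sequences. -/
def shiftEquiv (S : Type*) [MeasurableSpace S] : (ℤ → S) ≃ᵐ (ℤ → S) where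
  toFun x i := x (i + 1)
  invFun x i := x (i - 1)
  left_inv x := by funext i; simp
  right_inv x := by funext i; simp
  measurable_toFun := measurable_pi_lambda _ fun i => measurable_pi_apply (i + 1)
  measurable_invFun := measurable_pi_lambda _ fun i => measurable_pi_apply (i - 1)

theorem shiftEquiv_apply (x : ℤ → S) (i : ℤ) : shiftEquiv S x i = x (i + 1) := rfl

theorem iter_shiftEquiv_apply (k : ℤ) (x : ℤ → S) (i : ℤ) :
    iter (shiftEquiv S) k x i = x (i + k) := by
  induction k using Int.induction_on generalizing i with
  | zero => simp [iter_zero]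
  | succ n ih =>
    rw [iter_add_one, Function.comp_apply, shiftEquiv_apply, ih]
    congr 1; ring
  | pred n ih =>
    have h : iter (shiftEquiv S) (-(n : ℤ))
        = shiftEquiv S ∘ iter (shiftEquiv S) (-(n : ℤ) - 1) := by
      rw [← iter_add_one, sub_add_cancel]
    have h1 := ih (i - 1)
    rw [h, Function.comp_apply, shiftEquiv_apply, sub_add_cancel] at h1
    rw [h1]
    congr 1; ring

/-- The past `σ`-algebra at time `0` of two-sided sequences. -/
@[reducible] def pathPast (S : Type*) [mS : MeasurableSpace S] : MeasurableSpace (ℤ → S) :=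
  ⨆ (i : ℤ) (_ : i ≤ 0), mS.comap fun x => x i

theorem pathPast_le : pathPast S ≤ MeasurableSpace.pi :=
  iSup₂_le fun i _ => (measurable_pi_apply i).comap_le

theorem comap_pathPast {α : Type*} {φ : α → ℤ → S} :
    (pathPast S).comap φ = ⨆ (i : ℤ) (_ : i ≤ 0), mS.comap fun ω => φ ω i := by
  simp only [pathPast, MeasurableSpace.comap_iSup, MeasurableSpace.comap_comp]
  rfl

theorem pathPast_le_comap : pathPast S ≤ (pathPast S).comap (shiftEquiv S) := by
  rw [comap_pathPast]
  refine iSup₂_le fun i hi => ?_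
  refine le_trans (le_of_eq ?_) (le_iSup₂ (i - 1) (by omega))
  simp only [shiftEquiv_apply, sub_add_cancel]

theorem comap_shiftFiltration (ξ : ℤ → Ω → S) (hξ : ∀ i, Measurable (ξ i)) (k : ℤ) :
    (shiftFiltration (pathPast S) (shiftEquiv S) pathPast_le pathPast_le_comap k).comap
      (fun ω i => ξ i ω) = pastFiltration ξ hξ k := by
  change ((pathPast S).comap (iter (shiftEquiv S) k)).comap _
    = ⨆ (i : ℤ) (_ : i ≤ k), mS.comap (ξ i)
  rw [MeasurableSpace.comap_comp, comap_pathPast]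
  simp only [Function.comp, iter_shiftEquiv_apply]
  refine le_antisymm (iSup₂_le fun i hi => ?_) (iSup₂_le fun i hi => ?_)
  · exact le_iSup₂ (f := fun (i : ℤ) (_ : i ≤ k) => mS.comap (ξ i)) (i + k) (by omega)
  · refine le_trans (le_of_eq ?_) (le_iSup₂ (i - k) (by omega))
    simp only [sub_add_cancel]

theorem exists_approx_of_isStationary {b : ℕ → ℝ} (hb : AdmissibleWeights b)
    (P : Measure Ω) [IsProbabilityMeasure P] (ξ : ℤ → Ω → S) (hξ : ∀ i, Measurable (ξ i))
    (hst : IsStationary ξ P) (f : S → ℝ) (hf : MemLp f 2 (P.map (ξ 0)))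
    (hslow : SlowCondition P (pastFiltration ξ hξ) (fun i ω => f (ξ i ω)) b) :
    ∃ D : ℤ → Ω → ℝ,
      IsASMartingaleApprox P (pastFiltration ξ hξ) (fun i ω => f (ξ i ω)) D := by
  set φ : Ω → ℤ → S := fun ω i => ξ i ω
  have hφm : Measurable φ := measurable_pi_lambda _ hξ
  set μ := P.map φ
  have hφ : MeasurePreserving φ P μ := ⟨hφm, rfl⟩
  have hμ : IsProbabilityMeasure μ := Measure.isProbabilityMeasure_map hφm.aemeasurable
  have hT : MeasurePreserving (shiftEquiv S) μ μ := by
    refine ⟨(shiftEquiv S).measurable, ?_⟩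
    rw [Measure.map_map (shiftEquiv S).measurable hφm]
    exact (hst 1).map_eq
  have heval : MeasurePreserving (fun x : ℤ → S => x 0) μ (P.map (ξ 0)) :=
    ⟨measurable_pi_apply 0, Measure.map_map (measurable_pi_apply 0) hφm⟩
  have hiter := measurePreserving_iter hT
  -- `f` is measurable only up to a null set of the marginal law. A measurable version `g` is used
  -- on path space, so the two processes agree only almost surely.
  obtain ⟨g, hg, hfg⟩ := hf.1
  have hgL : MemLp g 2 (P.map (ξ 0)) := (memLp_congr_ae hfg).1 hf
  have hX₀L : MemLp (fun x : ℤ → S => g (x 0)) 2 μ := hgL.comp_measurePreserving heval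
  have hX₀ : Measurable[pathPast S] fun x : ℤ → S => g (x 0) := by
    refine hg.measurable.comp ?_
    exact Measurable.mono (comap_measurable fun x : ℤ → S => x 0)
      (le_iSup₂ (f := fun (i : ℤ) (_ : i ≤ 0) => mS.comap fun x : ℤ → S => x i) 0 le_rfl) le_rfl
  have hX : ∀ k : ℤ, (fun ω => f (ξ k ω))
      =ᵐ[P] (fun x => g (iter (shiftEquiv S) k x 0)) ∘ φ := by
    intro k
    have h1 := ((heval.comp (hiter k)).comp hφ).quasiMeasurePreserving.ae_eq_comp hfg
    filter_upwards [h1] with ω h2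
    simp only [Function.comp, iter_shiftEquiv_apply, zero_add] at h2 ⊢
    exact h2
  have hslow' := hslow.of_comp_measurePreserving hφ (comap_shiftFiltration ξ hξ 0) hX
    fun k => (hX₀L.comp_measurePreserving (hiter k)).integrable one_le_two
  obtain ⟨D₀, hD⟩ := exists_approx_of_measurePreserving hb (pathPast S) μ (shiftEquiv S) hT
    pathPast_le pathPast_le_comap _ hX₀ hX₀L hslow'
  exact ⟨_, hD.comp_measurePreserving hφ (comap_shiftFiltration ξ hξ) hX⟩

end PathSpace

end MartApprox

theorem mainTheorem3 :
    -- sequences given by a measure preserving transformation: `X_i = X_0 ∘ T^i`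
    (∀ b : ℕ → ℝ, MartApprox.AdmissibleWeights b →
      ∀ (Ω : Type*) (F₀ : MeasurableSpace Ω) [mΩ : MeasurableSpace Ω] (P : Measure Ω) [IsProbabilityMeasure P]
        (T : Ω ≃ᵐ Ω) (_ : MeasurePreserving T P P)
        (hF₀ : F₀ ≤ mΩ) (hT : F₀ ≤ F₀.comap T)
        (X₀ : Ω → ℝ) (_ : Measurable[F₀] X₀) (_ : MemLp X₀ 2 P) (_ : ∫ ω, X₀ ω ∂P = 0),
        MartApprox.SlowCondition P (MartApprox.shiftFiltration F₀ T hF₀ hT)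
          (fun i ω => X₀ (MartApprox.iter T i ω)) b →
        ∃ D : ℤ → Ω → ℝ, (∀ (k : ℤ) (ω : Ω), D k ω = D 0 (MartApprox.iter T k ω)) ∧
          MartApprox.IsASMartingaleApprox P (MartApprox.shiftFiltration F₀ T hF₀ hT)
            (fun i ω => X₀ (MartApprox.iter T i ω)) D) ∧
    -- functions of a stationary Markov chain: `X_i = f(ξ_i)`
    (∀ b : ℕ → ℝ, MartApprox.AdmissibleWeights b →
      ∀ (Ω S : Type*) [MeasurableSpace Ω] [MeasurableSpace S]
        (P : Measure Ω) [IsProbabilityMeasure P]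
        (ξ : ℤ → Ω → S) (hξ : ∀ i, Measurable (ξ i))
        (_ : MartApprox.IsStationary ξ P) (_ : MartApprox.HasMarkovProperty ξ hξ P)
        (f : S → ℝ) (_ : MemLp f 2 (P.map (ξ 0))) (_ : ∫ x, f x ∂(P.map (ξ 0)) = 0),
        MartApprox.SlowCondition P (MartApprox.pastFiltration ξ hξ)
          (fun i ω => f (ξ i ω)) b →
        ∃ D : ℤ → Ω → ℝ,
          MartApprox.IsASMartingaleApprox P (MartApprox.pastFiltration ξ hξ)
            (fun i ω => f (ξ i ω)) D) ∧
    -- the example of admissible weights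
    (∀ γ : ℝ, 1 < γ → MartApprox.AdmissibleWeights (MartApprox.logWeights γ)) := by
  refine ⟨fun b hb Ω F₀ mΩ P _ T hTP hF₀ hT X₀ hX₀ hX₀L _ hslow => ?_,
    fun b hb Ω S _ _ P _ ξ hξ hst _ f hf _ hslow => ?_,
    fun γ hγ => MartApprox.admissibleWeights_logWeights hγ⟩
  · obtain ⟨D₀, hD⟩ := MartApprox.exists_approx_of_measurePreserving hb F₀ P T hTP hF₀ hT X₀
      hX₀ hX₀L hslow
    refine ⟨_, fun k ω => ?_, hD⟩
    simp only [MartApprox.iter_zero, id]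
  · exact MartApprox.exists_approx_of_isStationary hb P ξ hξ hst f hf hslow
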